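/- Let $\Omega\subset\mathbb R^N$ be a bounded domain (nonempty, open, connected) and let $K:\mathbb R^N\setminus\{0\}\to(0,\infty)$ be such that $\min\{|x|^2,1\}K(x)\in L^1(\mathbb R^N)$, $K(-x)=K(x)$, and $K(x)\ge\alpha|x|^{-(N+2s)}$ for all $x\ne0$, for some $\alpha>0$ and $s\in(0,1)$ with $N>2s$. Set $$\langle u,v\rangle=\int_{\mathbb R^{2N}}(u(x)-u(y))(v(x)-v(y))K(x-y)\,dx\,dy,\qquad \|u\|=\langle u,u\rangle^{1/2},$$ $$X_K(\Omega)=\{u\in L^2(\mathbb R^N):\ \|u\|<\infty,\ u=0\text{ a.e. in }\mathbb R^N\setminus\Omega\}.$$ Let $\rho\in L^\infty(\Omega)$, $\rho\not\equiv0$. A number $\lambda\in\mathbb R$ is an eigenvalue, with eigenfunction $u\in X_K(\Omega)\setminus\{0\}$ (a $\lambda$-eigenfunction), if $\langle u,v\rangle=\lambda\int_\Omega\rho uv\,dx$ for all $v\in X_K(\Omega)$. Let $\mathcal F_k$ be the set of $k$-dimensional linear subspaces of $X_K(\Omega)$, and let $F^\perp$ be the orthogonal complement of $F$ with respect to $\langle\cdot,\cdot\rangle$.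 Then for every integer $k\ge1$ $$\sup_{F\in\mathcal F_k}\ \inf_{u\in F,\,\|u\|=1}\int_\Omega\rho u^2\,dx=\inf_{F\in\mathcal F_{k-1}}\ \sup_{u\in F^\perp,\,\|u\|=1}\int_\Omega\rho u^2\,dx,\qquad(E_+)$$ $$\inf_{F\in\mathcal F_k}\ \sup_{u\in F,\,\|u\|=1}\int_\Omega\rho u^2\,dx=\sup_{F\in\mathcal F_{k-1}}\ \inf_{u\in F^\perp,\,\|u\|=1}\int_\Omega\rho u^2\,dx.\qquad(E_-)$$ If $\rho^+\not\equiv0$, let $\lambda_k(\rho)$, $k\ge1$, be the reciprocal of the common value in $(E_+)$; if $\rho^-\not\equiv0$, let $\lambda_{-k}(\rho)$, $k\ge1$, be the reciprocal of the common value in $(E_-)$. Call the integers $k\neq 0$ for which $\lambda_k(\rho)$ is so defined admissible. Then: 1. If $\rho^+\not\equiv0$, then $0<\lambda_1(\rho)<\lambda_2(\rho)\le\dots\le\lambda_k(\rho)\le\dots\to\infty$. 2. If $\rho^-\not\equiv0$, then $0>\lambda_{-1}(\rho)>\lambda_{-2}(\rho)\ge\dots\ge\lambda_{-k}(\rho)\ge\dots\to-\infty$.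 3. There are $e_k\in X_K(\Omega)$, for all admissible $k$, such that $e_k$ is a $\lambda_k(\rho)$-eigenfunction and $\langle e_k,e_h\rangle=\delta_{kh}$ for all admissible $k,h$. 4. If $\rho^+\not\equiv0$, all suprema and infima in $(E_+)$ are attained: the inner ones for every $F$ in question, the outer ones at $F=\mathrm{span}(e_1,\dots,e_k)$ and $F=\mathrm{span}(e_1,\dots,e_{k-1})$ respectively, and for these two subspaces the inner extremum is attained at $e_k$, with value $\lambda_k(\rho)^{-1}$. If $\rho^-\not\equiv0$, the same holds for $(E_-)$ with $e_{-1},\dots,e_{-k}$ and $\lambda_{-k}(\rho)^{-1}$. 5. If $\rho\ge0$ a.e. in $\Omega$, every eigenvalue is positive; if $\rho\le0$ a.e. in $\Omega$, every eigenvalue is negative. -/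

import Mathlib

open MeasureTheory Filter Topology
open scoped ENNReal

namespace NonlocalEig

/-- `ℝᴺ` with its Euclidean norm and Lebesgue measure. -/
abbrev Euc (N : ℕ) : Type := EuclideanSpace ℝ (Fin N)

/-- The kernels `K : ℝᴺ \ {0} → (0, ∞)`: `min(|x|², 1) K` is integrable,
`K(x) ≥ α |x|^{-(N+2s)}` off the origin for some `α > 0` and `s ∈ (0,1)` with `N > 2s`
(so that `K > 0` off the origin), and `K` is even. The value at the origin is irrelevant. -/
structure AdmissibleKernel (N : ℕ) where
  /-- the kernel, as a function on all of `ℝᴺ` -/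
  toFun : Euc N → ℝ
  integrable_min_mul : Integrable (fun x => min (‖x‖ ^ 2) 1 * toFun x) volume
  lower_bound : ∃ α s : ℝ, 0 < α ∧ 0 < s ∧ s < 1 ∧ 2 * s < N ∧
    ∀ x : Euc N, x ≠ 0 → α * ‖x‖ ^ (-((N : ℝ) + 2 * s)) ≤ toFun x
  even : ∀ x : Euc N, x ≠ 0 → toFun (-x) = toFun x

variable {N : ℕ}

theorem AdmissibleKernel.aemeasurable (K : AdmissibleKernel N) :
    AEMeasurable K.toFun volume := by
  have h : K.toFun = fun x => (min (‖x‖ ^ 2) 1)⁻¹ * (min (‖x‖ ^ 2) 1 * K.toFun x)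
      + Set.indicator {0} (fun _ => K.toFun 0) x := by
    funext x
    by_cases hx : x = 0
    · subst hx; simp
    · have : min (‖x‖ ^ 2) 1 ≠ 0 := by
        have : 0 < ‖x‖ := norm_pos_iff.mpr hx
        positivity
      simp [hx, this]
  rw [h]
  have h1 : Measurable fun x : Euc N => (min (‖x‖ ^ 2) 1)⁻¹ := by fun_prop
  exact (h1.aemeasurable.mul K.integrable_min_mul.aestronglyMeasurable.aemeasurable).add
    ((measurable_const.indicator (measurableSet_singleton 0)).aemeasurable)

/-- `[u]_K² = ∬ (u(x) - u(y))² K(x - y) dx dy`, with values in `[0, ∞]`. -/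
noncomputable def energy (K : AdmissibleKernel N) (u : Euc N → ℝ) : ℝ≥0∞ :=
  ∫⁻ p : Euc N × Euc N, ENNReal.ofReal ((u p.1 - u p.2) ^ 2 * K.toFun (p.1 - p.2))
    ∂(volume.prod volume)

/-- `⟨u, v⟩ = ∬ (u(x) - u(y)) (v(x) - v(y)) K(x - y) dx dy`. -/
noncomputable def kInner (K : AdmissibleKernel N) (u v : Euc N → ℝ) : ℝ :=
  ∫ p : Euc N × Euc N, (u p.1 - u p.2) * (v p.1 - v p.2) * K.toFun (p.1 - p.2)
    ∂(volume.prod volume)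

/-- `‖u‖ = [u]_K = ⟨u, u⟩^{1/2}`. -/
noncomputable def kNorm (K : AdmissibleKernel N) (u : Euc N → ℝ) : ℝ :=
  Real.sqrt (kInner K u u)

theorem ae_prod_of_ae {u v : Euc N → ℝ} (h : u =ᵐ[volume] v) :
    ∀ᵐ p : Euc N × Euc N ∂(volume.prod volume), u p.1 = v p.1 ∧ u p.2 = v p.2 :=
  (Measure.quasiMeasurePreserving_fst.ae h).and (Measure.quasiMeasurePreserving_snd.ae h)

theorem energy_congr (K : AdmissibleKernel N) {u v : Euc N → ℝ} (h : u =ᵐ[volume] v) :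
    energy K u = energy K v := by
  refine lintegral_congr_ae ?_
  filter_upwards [ae_prod_of_ae h] with p hp
  rw [hp.1, hp.2]

theorem kInner_congr (K : AdmissibleKernel N) {u u' v v' : Euc N → ℝ}
    (h : u =ᵐ[volume] u') (h' : v =ᵐ[volume] v') : kInner K u v = kInner K u' v' := by
  refine integral_congr_ae ?_
  filter_upwards [ae_prod_of_ae h, ae_prod_of_ae h'] with p hp hp'
  rw [hp.1, hp.2, hp'.1, hp'.2]

theorem ae_sub_ne_zero (K : AdmissibleKernel N) :
    ∀ᵐ p : Euc N × Euc N ∂(volume.prod volume), p.1 - p.2 ≠ 0 := by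
  have hN : 0 < N := by
    obtain ⟨_, s, _, hs, _, hN, _⟩ := K.lower_bound
    have : (0 : ℝ) < N := by linarith
    exact_mod_cast this
  have : Nonempty (Fin N) := ⟨⟨0, hN⟩⟩
  have h : ∀ᵐ x : Euc N ∂volume, x ≠ 0 := by
    simp [ae_iff]
  exact (quasiMeasurePreserving_sub_of_right_invariant volume volume).ae h

theorem AdmissibleKernel.nonneg (K : AdmissibleKernel N) {x : Euc N} (hx : x ≠ 0) :
    0 ≤ K.toFun x := by
  obtain ⟨α, s, hα, _, _, _, h⟩ := K.lower_bound
  exact le_trans (by positivity) (h x hx)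

theorem AdmissibleKernel.aemeasurable_sub (K : AdmissibleKernel N) :
    AEMeasurable (fun p : Euc N × Euc N => K.toFun (p.1 - p.2)) (volume.prod volume) :=
  K.aemeasurable.comp_quasiMeasurePreserving
    (quasiMeasurePreserving_sub_of_right_invariant volume volume)

theorem energy_add_lt_top (K : AdmissibleKernel N) {u v : Euc N → ℝ}
    (hum : AEMeasurable u volume) (hu : energy K u < ⊤) (hv : energy K v < ⊤) :
    energy K (u + v) < ⊤ := by
  have hm : AEMeasurable (fun p : Euc N × Euc N =>
      ENNReal.ofReal ((u p.1 - u p.2) ^ 2 * K.toFun (p.1 - p.2))) (volume.prod volume) :=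
    ((((hum.comp_quasiMeasurePreserving Measure.quasiMeasurePreserving_fst).sub
      (hum.comp_quasiMeasurePreserving Measure.quasiMeasurePreserving_snd)).pow_const 2).mul
      K.aemeasurable_sub).ennreal_ofReal
  have hle : energy K (u + v) ≤ 2 * (energy K u + energy K v) := by
    unfold energy
    rw [← lintegral_add_left' hm, ← lintegral_const_mul' _ _ (by simp)]
    refine lintegral_mono_ae ?_
    filter_upwards [ae_sub_ne_zero K] with p hp
    have hK := K.nonneg hp
    have h2 : ∀ t : ℝ≥0∞, 2 * t = ENNReal.ofReal 2 * t := fun t => by simp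
    rw [← ENNReal.ofReal_add (by positivity) (by positivity), h2,
      ← ENNReal.ofReal_mul (by norm_num)]
    refine ENNReal.ofReal_le_ofReal ?_
    have : (u p.1 + v p.1 - (u p.2 + v p.2)) ^ 2
        ≤ 2 * ((u p.1 - u p.2) ^ 2 + (v p.1 - v p.2) ^ 2) := by
      nlinarith [sq_nonneg ((u p.1 - u p.2) - (v p.1 - v p.2))]
    calc _ ≤ 2 * ((u p.1 - u p.2) ^ 2 + (v p.1 - v p.2) ^ 2) * K.toFun (p.1 - p.2) :=
          mul_le_mul_of_nonneg_right this hK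
      _ = _ := by ring
  exact hle.trans_lt (ENNReal.mul_lt_top (by simp) (ENNReal.add_lt_top.mpr ⟨hu, hv⟩))

theorem energy_smul_lt_top (K : AdmissibleKernel N) (c : ℝ) {u : Euc N → ℝ}
    (hu : energy K u < ⊤) : energy K (c • u) < ⊤ := by
  have : energy K (c • u) = ENNReal.ofReal (c ^ 2) * energy K u := by
    unfold energy
    rw [← lintegral_const_mul' _ _ (by simp)]
    refine lintegral_congr fun p => ?_
    rw [← ENNReal.ofReal_mul (by positivity)]
    congr 1
    simp only [Pi.smul_apply, smul_eq_mul]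
    ring
  rw [this]
  exact ENNReal.mul_lt_top (by simp) hu

/-- `X_K(Ω) = {u ∈ L²(ℝᴺ) : [u]_K < ∞, u = 0 a.e. in ℝᴺ \ Ω}`. -/
noncomputable def XK (K : AdmissibleKernel N) (Ω : Set (Euc N)) :
    Submodule ℝ (Lp ℝ 2 (volume : Measure (Euc N))) where
  carrier := {u | energy K u < ⊤ ∧ ∀ᵐ x ∂(volume : Measure (Euc N)), x ∉ Ω → u x = 0}
  zero_mem' := by
    have h0 := Lp.coeFn_zero ℝ 2 (volume : Measure (Euc N))
    refine ⟨?_, ?_⟩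
    · rw [energy_congr K h0]
      simp [energy]
    · filter_upwards [h0] with x _ _
      simp
  add_mem' := by
    rintro u v ⟨hu, hu'⟩ ⟨hv, hv'⟩
    have h := Lp.coeFn_add u v
    refine ⟨?_, ?_⟩
    · rw [energy_congr K h]
      exact energy_add_lt_top K (Lp.aestronglyMeasurable u).aemeasurable hu hv
    · filter_upwards [h, hu', hv'] with x hx h1 h2 hΩ
      rw [hx, Pi.add_apply, h1 hΩ, h2 hΩ, add_zero]
  smul_mem' := by
    rintro c u ⟨hu, hu'⟩
    have h := Lp.coeFn_smul c u
    refine ⟨?_, ?_⟩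
    · rw [energy_congr K h]
      exact energy_smul_lt_top K c hu
    · filter_upwards [h, hu'] with x hx h1 hΩ
      rw [hx, Pi.smul_apply, h1 hΩ, smul_zero]

variable (K : AdmissibleKernel N) (Ω : Set (Euc N)) (ρ : Euc N → ℝ)

/-- The scalar product of `X_K(Ω)`. -/
noncomputable def ip (u v : XK K Ω) : ℝ := kInner K (u : Lp ℝ 2 volume) (v : Lp ℝ 2 volume)

/-- The norm `‖u‖ = [u]_K` of `X_K(Ω)` (not the `L²` norm that `X_K(Ω)` inherits as a
subspace of `L²(ℝᴺ)`). -/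
noncomputable def nrm (u : XK K Ω) : ℝ := kNorm K (u : Lp ℝ 2 volume)

/-- `∫_Ω ρ u v dx`. -/
noncomputable def weightForm (u v : XK K Ω) : ℝ :=
  ∫ x in Ω, ρ x * ((u : Lp ℝ 2 volume) x) * ((v : Lp ℝ 2 volume) x)

/-- `∫_Ω ρ u² dx`. -/
noncomputable def weightQuad (u : XK K Ω) : ℝ :=
  ∫ x in Ω, ρ x * ((u : Lp ℝ 2 volume) x) ^ 2

/-- `u ∈ X_K(Ω) \ {0}` is a weak solution of `L_K u = lam ρ u` in `Ω`, `u = 0` off `Ω`. -/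
def IsEigenfunction (lam : ℝ) (u : XK K Ω) : Prop :=
  u ≠ 0 ∧ ∀ v : XK K Ω, ip K Ω u v = lam * weightForm K Ω ρ u v

/-- `lam` belongs to the spectrum `σ(ρ)`. -/
def IsEigenvalue (lam : ℝ) : Prop := ∃ u : XK K Ω, IsEigenfunction K Ω ρ lam u

/-- `ℱ_k`: the `k`-dimensional linear subspaces of `X_K(Ω)`. -/
def subspacesOfDim (k : ℕ) : Set (Submodule ℝ (XK K Ω)) :=
  {F | FiniteDimensional ℝ F ∧ Module.finrank ℝ F = k}

/-- `{u ∈ F : ‖u‖ = 1}`. -/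
def unitSphere (F : Submodule ℝ (XK K Ω)) : Set (XK K Ω) := {u | u ∈ F ∧ nrm K Ω u = 1}

/-- `{u ∈ F^⊥ : ‖u‖ = 1}`, orthogonality being that of `X_K(Ω)`. -/
def perpUnitSphere (F : Submodule ℝ (XK K Ω)) : Set (XK K Ω) :=
  {u | (∀ v ∈ F, ip K Ω u v = 0) ∧ nrm K Ω u = 1}

/-- `inf_{u ∈ F, ‖u‖ = 1} ∫_Ω ρ u²`. -/
noncomputable def infOn (F : Submodule ℝ (XK K Ω)) : ℝ :=
  sInf (weightQuad K Ω ρ '' unitSphere K Ω F)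

/-- `sup_{u ∈ F, ‖u‖ = 1} ∫_Ω ρ u²`. -/
noncomputable def supOn (F : Submodule ℝ (XK K Ω)) : ℝ :=
  sSup (weightQuad K Ω ρ '' unitSphere K Ω F)

/-- `inf_{u ∈ F^⊥, ‖u‖ = 1} ∫_Ω ρ u²`. -/
noncomputable def infOnPerp (F : Submodule ℝ (XK K Ω)) : ℝ :=
  sInf (weightQuad K Ω ρ '' perpUnitSphere K Ω F)

/-- `sup_{u ∈ F^⊥, ‖u‖ = 1} ∫_Ω ρ u²`. -/
noncomputable def supOnPerp (F : Submodule ℝ (XK K Ω)) : ℝ :=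
  sSup (weightQuad K Ω ρ '' perpUnitSphere K Ω F)

/-- `sup_{F ∈ ℱ_k} inf_{u ∈ F, ‖u‖ = 1} ∫_Ω ρ u²`. -/
noncomputable def supInf (k : ℕ) : ℝ := sSup (infOn K Ω ρ '' subspacesOfDim K Ω k)

/-- `inf_{F ∈ ℱ_{k-1}} sup_{u ∈ F^⊥, ‖u‖ = 1} ∫_Ω ρ u²`, for `k ≥ 1`. -/
noncomputable def infSupPerp (k : ℕ) : ℝ :=
  sInf (supOnPerp K Ω ρ '' subspacesOfDim K Ω (k - 1))

/-- `inf_{F ∈ ℱ_k} sup_{u ∈ F, ‖u‖ = 1} ∫_Ω ρ u²`. -/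
noncomputable def infSup (k : ℕ) : ℝ := sInf (supOn K Ω ρ '' subspacesOfDim K Ω k)

/-- `sup_{F ∈ ℱ_{k-1}} inf_{u ∈ F^⊥, ‖u‖ = 1} ∫_Ω ρ u²`, for `k ≥ 1`. -/
noncomputable def supInfPerp (k : ℕ) : ℝ :=
  sSup (infOnPerp K Ω ρ '' subspacesOfDim K Ω (k - 1))

/-- `λ_k(ρ)` for a nonzero integer `k`: for `k > 0` its reciprocal is the sup-inf over `ℱ_k`,
for `k < 0` its reciprocal is the inf-sup over `ℱ_{|k|}`. (Meaningful if `k > 0` and `ρ⁺ ≢ 0`,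
or `k < 0` and `ρ⁻ ≢ 0`.) -/
noncomputable def eig (k : ℤ) : ℝ :=
  if 0 < k then (supInf K Ω ρ k.natAbs)⁻¹ else (infSup K Ω ρ k.natAbs)⁻¹

/-- `k` is admissible: `k > 0` and `ρ⁺ ≢ 0` in `Ω`, or `k < 0` and `ρ⁻ ≢ 0` in `Ω`. -/
def Admissible (Ω : Set (Euc N)) (ρ : Euc N → ℝ) (k : ℤ) : Prop :=
  (0 < k ∧ ¬ ρ⁺ =ᵐ[volume.restrict Ω] 0) ∨ (k < 0 ∧ ¬ ρ⁻ =ᵐ[volume.restrict Ω] 0)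

end NonlocalEig

/-! With the scalar product `ip`, the space X_K(Ω) is a Hilbert space that embeds compactly in L².
If J is the embedding and r in L^∞(ℝᴺ) extends ρ, the operator T = J* ∘ (multiplication by r) ∘ J is
compact and symmetric, and ⟨Tu, v⟩ = ∫_Ω ρuv. Hence λ ≠ 0 is an eigenvalue exactly when 1/λ is an
eigenvalue of T, and the theorem becomes the spectral theory of T together with the Courant–Fischer
principle.

The Hilbert space side rests on three facts. The Poincaré inequality (`exists_poincare`) compares u
on Ω with its zero values on a ball away from Ω. Completeness follows from this inequality and
Fatou's lemma. Compactness (`HK.isCompactOperator_toLp`) holds because averaging over cubes of side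
1/n has finite rank and differs from J by O(n^{-s}) in operator norm: the lower bound on K controls
the oscillation of u on small cubes.

If ρ⁺ ≢ 0, the form ∫ρu² is positive definite on subspaces of X_K(Ω) of every dimension
(`exists_positive_subspace`): indicators of disjoint subsets of {ρ > 0} span such a space in L², and
by density they can be moved into X_K(Ω). Maximizing the form over the unit sphere of the orthogonal
complement of the eigenvectors already found (`exists_isPosEigenSeq`) then never stops, and gives
eigenvalues μ_n of T decreasing to 0. A dimension count gives both min-max formulas, since a space
of dimension n + 1 always meets the orthogonal complement of a space of dimension n.

The largest μ is simple (`isPosEigenSeq_one_lt_zero`): a maximizer has constant sign, because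
passing to |u| leaves ∫ρu² unchanged and does not increase the energy, while a two-dimensional
eigenspace would contain a nonzero function of mean zero.

All negative statements are the positive ones for -ρ. The formulas `supInf` = `infSupPerp` are also
needed when ρ ≤ 0 and ρ ≢ 0; then both sides are 0, as the negative eigenvalues of T accumulate
there. -/

namespace CompactSymmetric

/-! ### Compact symmetric operators on a real Hilbert space. -/

variable {H : Type*} [NormedAddCommGroup H] [InnerProductSpace ℝ H]

local notation "⟪" x ", " y "⟫" => inner ℝ x y

theorem exists_subseq_tendsto {E F : Type*} [NormedAddCommGroup E] [NormedSpace ℝ E]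
    [NormedAddCommGroup F] [NormedSpace ℝ F] (T : E →L[ℝ] F) (hT : IsCompactOperator T)
    {u : ℕ → E} {R : ℝ} (hu : ∀ n, ‖u n‖ ≤ R) :
    ∃ w : F, ∃ φ : ℕ → ℕ, StrictMono φ ∧ Tendsto (fun n => T (u (φ n))) atTop (𝓝 w) := by
  have hc := hT.isCompact_closure_image_closedBall (f := (T : E →ₗ[ℝ] F)) R
  obtain ⟨w, -, φ, hφ, h⟩ := hc.tendsto_subseq (x := fun n => T (u n)) fun n =>
    subset_closure ⟨u n, by simpa using hu n, rfl⟩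
  exact ⟨w, φ, hφ, h⟩

theorem quad_le_opNorm (T : H →L[ℝ] H) (u : H) : ⟪T u, u⟫ ≤ ‖T‖ * ‖u‖ ^ 2 := by
  calc ⟪T u, u⟫ ≤ ‖T u‖ * ‖u‖ := real_inner_le_norm _ _
    _ ≤ ‖T‖ * ‖u‖ * ‖u‖ := by gcongr; exact T.le_opNorm u
    _ = _ := by ring

theorem quad_smul (T : H →L[ℝ] H) (c : ℝ) (u : H) : ⟪T (c • u), c • u⟫ = c ^ 2 * ⟪T u, u⟫ := by
  simp only [map_smul, inner_smul_left, inner_smul_right, conj_trivial]; ring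

theorem quad_add (T : H →L[ℝ] H) (hs : ∀ u v, ⟪T u, v⟫ = ⟪u, T v⟫) (u v : H) :
    ⟪T (u + v), u + v⟫ = ⟪T u, u⟫ + 2 * ⟪T u, v⟫ + ⟪T v, v⟫ := by
  simp only [map_add, inner_add_left, inner_add_right]
  rw [hs v u, real_inner_comm (T u) v]; ring

theorem quad_sub (T : H →L[ℝ] H) (hs : ∀ u v, ⟪T u, v⟫ = ⟪u, T v⟫) (u v : H) :
    ⟪T (u - v), u - v⟫ = ⟪T u, u⟫ - 2 * ⟪T u, v⟫ + ⟪T v, v⟫ := by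
  simp only [map_sub, inner_sub_left, inner_sub_right]
  rw [hs v u, real_inner_comm (T u) v]; ring

theorem exists_unit_of_ne_zero {T : H →L[ℝ] H} {M : Submodule ℝ H} {u : H} (hu : u ∈ M)
    (h0 : u ≠ 0) : ∃ v ∈ M, ‖v‖ = 1 ∧ ⟪T u, u⟫ = ‖u‖ ^ 2 * ⟪T v, v⟫ := by
  have hn : ‖u‖ ≠ 0 := norm_ne_zero_iff.mpr h0
  refine ⟨‖u‖⁻¹ • u, M.smul_mem _ hu, by simp [norm_smul, hn], ?_⟩
  rw [quad_smul]
  field_simp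

/-- The quadratic form of a compact symmetric operator attains its maximum on the unit sphere of
a closed subspace on which it takes a positive value. -/
theorem exists_isMax [CompleteSpace H] (T : H →L[ℝ] H) (hT : IsCompactOperator T)
    (hs : ∀ u v, ⟪T u, v⟫ = ⟪u, T v⟫) (M : Submodule ℝ H) (hM : IsClosed (M : Set H))
    (hpos : ∃ u ∈ M, 0 < ⟪T u, u⟫) :
    ∃ e ∈ M, ‖e‖ = 1 ∧ 0 < ⟪T e, e⟫ ∧ ∀ u ∈ M, ⟪T u, u⟫ ≤ ⟪T e, e⟫ * ‖u‖ ^ 2 := by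
  set S : Set ℝ := (fun u => ⟪T u, u⟫) '' {u | u ∈ M ∧ ‖u‖ = 1} with hS
  have hbdd : BddAbove S := by
    refine ⟨‖T‖, ?_⟩
    rintro _ ⟨u, ⟨_, hu⟩, rfl⟩
    simpa [hu] using quad_le_opNorm T u
  obtain ⟨u₀, hu₀, hp₀⟩ := hpos
  have h0 : u₀ ≠ 0 := by rintro rfl; simp at hp₀
  obtain ⟨v₀, hv₀, hn₀, hq₀⟩ := exists_unit_of_ne_zero (T := T) hu₀ h0
  have hv₀S : ⟪T v₀, v₀⟫ ∈ S := ⟨v₀, ⟨hv₀, hn₀⟩, rfl⟩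
  set μ := sSup S with hμ
  have hμpos : 0 < μ := by
    have : 0 < ⟪T v₀, v₀⟫ := by
      by_contra hneg
      have : 0 < ‖u₀‖ ^ 2 * ⟪T v₀, v₀⟫ := hq₀ ▸ hp₀
      nlinarith [sq_nonneg ‖u₀‖]
    exact this.trans_le (le_csSup hbdd hv₀S)
  have hle : ∀ u ∈ M, ⟪T u, u⟫ ≤ μ * ‖u‖ ^ 2 := by
    intro u hu
    by_cases hz : u = 0
    · simp [hz]
    obtain ⟨v, hv, hn, hq⟩ := exists_unit_of_ne_zero (T := T) hu hz
    rw [hq, mul_comm]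
    exact mul_le_mul_of_nonneg_right (le_csSup hbdd ⟨v, ⟨hv, hn⟩, rfl⟩) (sq_nonneg _)
  obtain ⟨x, -, hx, hxS⟩ := exists_seq_tendsto_sSup ⟨_, hv₀S⟩ hbdd
  choose u hu huq using hxS
  obtain ⟨w, φ, hφ, hw⟩ := exists_subseq_tendsto T hT (u := u) (R := 1) fun n => (hu n).2.le
  set y : ℕ → H := fun n => u (φ n) with hy
  have hyM : ∀ n, y n ∈ M := fun n => (hu _).1
  have hyn : ∀ n, ‖y n‖ = 1 := fun n => (hu _).2
  have hyq : Tendsto (fun n => ⟪T (y n), y n⟫) atTop (𝓝 μ) :=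
    (hx.comp hφ.tendsto_atTop).congr fun n => (huq _).symm
  -- Parallelogram law for both the form and the norm: the form at `y n + y m` is at most μ(4 - ‖y n
  -- - y m‖²). Where T(y n) converges, a maximizing sequence is therefore Cauchy in norm, and no
  -- weak limits are needed.
  have key : ∀ n m, μ * ‖y n - y m‖ ^ 2 ≤ 2 * (μ - ⟪T (y n), y n⟫) + 2 * (μ - ⟪T (y m), y m⟫)
      + 2 * ‖T (y n) - T (y m)‖ := by
    intro n m
    have h1 := hle _ (M.add_mem (hyM n) (hyM m))
    have h2 := parallelogram_law_with_norm ℝ (y n) (y m)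
    have h3 := quad_add T hs (y n) (y m)
    have h4 := quad_sub T hs (y n) (y m)
    have h5 : ⟪T (y n - y m), y n - y m⟫ ≤ ‖T (y n) - T (y m)‖ * 2 := by
      rw [map_sub]
      refine (real_inner_le_norm _ _).trans ?_
      gcongr
      exact (norm_sub_le _ _).trans (by rw [hyn, hyn]; norm_num)
    have h6 : ‖y n + y m‖ ^ 2 = 4 - ‖y n - y m‖ ^ 2 := by
      rw [hyn, hyn] at h2; nlinarith
    rw [h6] at h1
    linarith
  have hcau : CauchySeq y := by
    rw [Metric.cauchySeq_iff]
    intro ε hε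
    have hTc : CauchySeq (fun n => T (y n)) := hw.cauchySeq
    -- The three error terms in `key` add up to less than 6δ < με².
    set δ := μ * ε ^ 2 / 8 with hδ
    have hδp : 0 < δ := by positivity
    obtain ⟨N₁, hN₁⟩ := Metric.cauchySeq_iff.mp hTc δ hδp
    obtain ⟨N₂, hN₂⟩ := Metric.tendsto_atTop.mp hyq δ hδp
    refine ⟨max N₁ N₂, fun m hm n hn => ?_⟩
    have h1 := hN₁ m (le_of_max_le_left hm) n (le_of_max_le_left hn)
    have h2 := hN₂ m (le_of_max_le_right hm)
    have h3 := hN₂ n (le_of_max_le_right hn)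
    rw [Real.dist_eq, abs_lt] at h2 h3
    rw [dist_eq_norm] at h1 ⊢
    have h4 := key m n
    have : ‖y m - y n‖ ^ 2 < ε ^ 2 := by
      have : μ * ‖y m - y n‖ ^ 2 < μ * ε ^ 2 := by linarith [h2.1, h3.1]
      exact lt_of_mul_lt_mul_left this hμpos.le
    exact lt_of_pow_lt_pow_left₀ 2 hε.le this
  obtain ⟨e, he⟩ := cauchySeq_tendsto_of_complete hcau
  have heq : ⟪T e, e⟫ = μ :=
    tendsto_nhds_unique (((T.continuous.tendsto e).comp he).inner he) hyq
  refine ⟨e, hM.mem_of_tendsto he (Eventually.of_forall hyM), ?_, by rw [heq]; exact hμpos,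
    by rw [heq]; exact hle⟩
  exact tendsto_nhds_unique he.norm (tendsto_const_nhds.congr fun n => (hyn n).symm)

/-- First variation: μ‖e + tv‖² - ⟨T(e + tv), e + tv⟩ is a nonnegative quadratic polynomial in t
without constant term, so its linear coefficient vanishes. -/
theorem inner_eq_of_isMax (T : H →L[ℝ] H) (hs : ∀ u v, ⟪T u, v⟫ = ⟪u, T v⟫) {M : Submodule ℝ H}
    {μ : ℝ} (hmax : ∀ u ∈ M, ⟪T u, u⟫ ≤ μ * ‖u‖ ^ 2) {e : H} (he : e ∈ M)
    (heq : ⟪T e, e⟫ = μ * ‖e‖ ^ 2) {v : H} (hv : v ∈ M) : ⟪T e, v⟫ = μ * ⟪e, v⟫ := by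
  have h : ∀ t : ℝ, 0 ≤ (μ * ‖v‖ ^ 2 - ⟪T v, v⟫) * (t * t) + 2 * (μ * ⟪e, v⟫ - ⟪T e, v⟫) * t + 0 := by
    intro t
    have h1 := hmax _ (M.add_mem he (M.smul_mem t hv))
    rw [quad_add T hs, quad_smul, norm_add_sq_real, norm_smul, mul_pow, Real.norm_eq_abs, sq_abs,
      inner_smul_right, inner_smul_right] at h1
    nlinarith
  have := discrim_le_zero h
  rw [discrim] at this
  nlinarith [sq_nonneg (μ * ⟪e, v⟫ - ⟪T e, v⟫)]

/-- The complement of an invariant subspace is invariant by symmetry, so the residual Te - μe is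
itself an admissible test vector in the first variation. -/
theorem eigenvector_of_isMax (T : H →L[ℝ] H) (hs : ∀ u v, ⟪T u, v⟫ = ⟪u, T v⟫) {F : Submodule ℝ H}
    (hF : ∀ u ∈ F, T u ∈ F) {μ : ℝ} (hmax : ∀ u ∈ Fᗮ, ⟪T u, u⟫ ≤ μ * ‖u‖ ^ 2) {e : H} (he : e ∈ Fᗮ)
    (heq : ⟪T e, e⟫ = μ * ‖e‖ ^ 2) : T e = μ • e := by
  have hTe : T e ∈ Fᗮ := by
    rw [Submodule.mem_orthogonal]
    intro f hf
    rw [← hs]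
    exact (Submodule.mem_orthogonal _ _).mp he _ (hF f hf)
  have hm : T e - μ • e ∈ Fᗮ := Submodule.sub_mem _ hTe (Submodule.smul_mem _ _ he)
  have h := inner_eq_of_isMax T hs hmax he heq hm
  rw [← sub_eq_zero, ← inner_self_eq_zero (𝕜 := ℝ), inner_sub_left, h, inner_smul_left]
  simp

/-- The orthogonal projection of F to G has a nontrivial kernel. Every min-max inequality below
comes from this dimension count. -/
theorem exists_mem_orthogonal_of_finrank_lt {F G : Submodule ℝ H} [FiniteDimensional ℝ F]
    [FiniteDimensional ℝ G] (h : Module.finrank ℝ G < Module.finrank ℝ F) :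
    ∃ u ∈ F, u ≠ 0 ∧ u ∈ Gᗮ := by
  let f : F →ₗ[ℝ] G := (G.orthogonalProjectionOnto : H →ₗ[ℝ] G) ∘ₗ F.subtype
  obtain ⟨u, hu, h0⟩ := (Submodule.ne_bot_iff _).mp (LinearMap.ker_ne_bot_of_finrank_lt (f := f) h)
  refine ⟨u, u.2, by simpa using h0, ?_⟩
  have : G.orthogonalProjectionOnto (u : H) = 0 := hu
  rwa [Submodule.orthogonalProjectionOnto_eq_zero_iff] at this

theorem exists_isMinOn_of_finiteDimensional (T : H →L[ℝ] H) {F : Submodule ℝ H}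
    [FiniteDimensional ℝ F] (hF : F ≠ ⊥) :
    ∃ u ∈ F, ‖u‖ = 1 ∧ ∀ v ∈ F, ‖v‖ = 1 → ⟪T u, u⟫ ≤ ⟪T v, v⟫ := by
  obtain ⟨u₀, hu₀, h0⟩ := (Submodule.ne_bot_iff _).mp hF
  obtain ⟨v₀, hv₀, hn₀, -⟩ := exists_unit_of_ne_zero (T := T) hu₀ h0
  have hc : IsCompact (Metric.sphere (0 : F) 1) := isCompact_sphere _ _
  obtain ⟨u, hu, hmin⟩ := hc.exists_isMinOn (f := fun u : F => ⟪T u, (u : H)⟫)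
    ⟨⟨v₀, hv₀⟩, by simpa using hn₀⟩ (by fun_prop)
  refine ⟨u, u.2, by simpa using hu, fun v hv hn => ?_⟩
  exact hmin (show (⟨v, hv⟩ : F) ∈ _ by simpa using hn)

/-- A decreasing sequence of positive eigenvalues with orthonormal eigenvectors, exhausting the
positive part of the quadratic form. -/
structure IsPosEigenSeq (T : H →L[ℝ] H) (e : ℕ → H) (μ : ℕ → ℝ) : Prop where
  orthonormal : Orthonormal ℝ e
  pos : ∀ n, 0 < μ n
  eigen : ∀ n, T (e n) = μ n • e n
  le : ∀ n, ∀ u ∈ (Submodule.span ℝ (e '' Set.Iio n))ᗮ, ⟪T u, u⟫ ≤ μ n * ‖u‖ ^ 2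

theorem exists_isPosEigenSeq [CompleteSpace H] (T : H →L[ℝ] H) (hT : IsCompactOperator T)
    (hs : ∀ u v, ⟪T u, v⟫ = ⟪u, T v⟫)
    (hpos : ∀ k : ℕ, ∃ F : Submodule ℝ H, FiniteDimensional ℝ F ∧ Module.finrank ℝ F = k ∧
      ∀ u ∈ F, u ≠ 0 → 0 < ⟪T u, u⟫) :
    ∃ (e : ℕ → H) (μ : ℕ → ℝ), IsPosEigenSeq T e μ := by
  have hex : ∀ F : Submodule ℝ H, FiniteDimensional ℝ F → ∃ e ∈ Fᗮ, ‖e‖ = 1 ∧ 0 < ⟪T e, e⟫ ∧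
      ∀ u ∈ Fᗮ, ⟪T u, u⟫ ≤ ⟪T e, e⟫ * ‖u‖ ^ 2 := by
    intro F hF
    refine exists_isMax T hT hs Fᗮ (Submodule.isClosed_orthogonal _) ?_
    -- A positive definite subspace of one dimension more than F meets Fᗮ, so the form takes a
    -- positive value there and has a maximizer.
    obtain ⟨G, hG, hd, hGp⟩ := hpos (Module.finrank ℝ F + 1)
    obtain ⟨u, hu, h0, huF⟩ := exists_mem_orthogonal_of_finrank_lt (F := G) (G := F) (by omega)
    exact ⟨u, huF, hGp u hu h0⟩
  choose! p hp1 hp2 hp3 hp4 using hex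
  -- `p` picks a maximizer for each subspace, so the recursion runs on subspaces alone; the
  -- eigenvectors are `p (F n)`.
  let F : ℕ → Submodule ℝ H := fun n =>
    Nat.rec (motive := fun _ => Submodule ℝ H) ⊥ (fun _ G => G ⊔ Submodule.span ℝ {p G}) n
  have hF0 : F 0 = ⊥ := rfl
  have hFs : ∀ n, F (n + 1) = F n ⊔ Submodule.span ℝ {p (F n)} := fun n => rfl
  have hFd : ∀ n, FiniteDimensional ℝ ↥(F n) := by
    intro n
    induction n with
    | zero => rw [hF0]; infer_instance
    | succ n ih => rw [hFs]; infer_instance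
  have hspan : ∀ n, F n = Submodule.span ℝ ((fun i => p (F i)) '' Set.Iio n) := by
    intro n
    induction n with
    | zero => simp [hF0]
    | succ n ih =>
      rw [hFs]
      conv_lhs => rw [ih]
      have : Set.Iio (n + 1) = Set.Iio n ∪ {n} := by ext i; simp
      rw [this, Set.image_union, Submodule.span_union, Set.image_singleton, ← ih]
  have hmem : ∀ i n, i < n → p (F i) ∈ F n := by
    intro i n hin
    rw [hspan n]
    exact Submodule.subset_span ⟨i, hin, rfl⟩
  -- The two claims support each other: invariance of F n makes `p (F n)` an eigenvector, which
  -- makes F (n + 1) invariant.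
  have hinv : ∀ n, (∀ u ∈ F n, T u ∈ F n) ∧
      T (p (F n)) = ⟪T (p (F n)), p (F n)⟫ • p (F n) := by
    have hstep : ∀ n, (∀ u ∈ F n, T u ∈ F n) →
        T (p (F n)) = ⟪T (p (F n)), p (F n)⟫ • p (F n) := by
      intro n hn
      refine eigenvector_of_isMax T hs hn (hp4 _ (hFd n)) (hp1 _ (hFd n)) ?_
      rw [hp2 _ (hFd n)]; simp
    intro n
    induction n with
    | zero => exact ⟨by simp [hF0], hstep 0 (by simp [hF0])⟩
    | succ n ih =>
      have h1 : ∀ u ∈ F (n + 1), T u ∈ F (n + 1) := by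
        intro u hu
        rw [hFs, Submodule.mem_sup] at hu ⊢
        obtain ⟨v, hv, w, hw, rfl⟩ := hu
        obtain ⟨c, rfl⟩ := Submodule.mem_span_singleton.mp hw
        refine ⟨T v, ih.1 v hv, T (c • p (F n)), ?_, by simp⟩
        rw [map_smul, ih.2]
        exact Submodule.smul_mem _ _ (Submodule.smul_mem _ _ (Submodule.mem_span_singleton_self _))
      exact ⟨h1, hstep (n + 1) h1⟩
  refine ⟨fun n => p (F n), fun n => ⟪T (p (F n)), p (F n)⟫, ?_, fun n => hp3 _ (hFd n),
    fun n => (hinv n).2, fun n u hu => hp4 _ (hFd n) u (by rw [hspan n]; exact hu)⟩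
  refine ⟨fun n => hp2 _ (hFd n), ?_⟩
  have hlt : ∀ i j, i < j → ⟪p (F i), p (F j)⟫ = 0 := fun i j hij =>
    (Submodule.mem_orthogonal _ _).mp (hp1 _ (hFd j)) _ (hmem i j hij)
  intro i j hij
  rcases lt_or_gt_of_ne hij with h | h
  · exact hlt i j h
  · rw [real_inner_comm]; exact hlt j i h

namespace IsPosEigenSeq

variable {T : H →L[ℝ] H} {e : ℕ → H} {μ : ℕ → ℝ}

theorem quad_eq (h : IsPosEigenSeq T e μ) (n : ℕ) : ⟪T (e n), e n⟫ = μ n := by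
  rw [h.eigen, inner_smul_left, real_inner_self_eq_norm_sq, h.orthonormal.1 n]; simp

theorem mem_orthogonal (h : IsPosEigenSeq T e μ) {m n : ℕ} (hmn : n ≤ m) :
    e m ∈ (Submodule.span ℝ (e '' Set.Iio n))ᗮ := by
  rw [Submodule.mem_orthogonal]
  intro u hu
  have : Submodule.span ℝ (e '' Set.Iio n) ≤ LinearMap.ker (innerₛₗ ℝ (e m)) := by
    rw [Submodule.span_le]
    rintro _ ⟨i, hi, rfl⟩
    have : i < n := hi
    exact h.orthonormal.2 (show m ≠ i by omega)
  rw [real_inner_comm]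
  exact this hu

theorem antitone (h : IsPosEigenSeq T e μ) : Antitone μ := by
  refine antitone_nat_of_succ_le fun n => ?_
  have := h.le n (e (n + 1)) (h.mem_orthogonal (by omega))
  rw [h.quad_eq, h.orthonormal.1] at this
  simpa using this

/-- If μ_n ≥ c > 0 for all n, the vectors T e_n = μ_n e_n stay at distance at least √2 c from one
another, which compactness forbids. -/
theorem tendsto (h : IsPosEigenSeq T e μ) (hT : IsCompactOperator T) : Tendsto μ atTop (𝓝 0) := by
  have hbdd : BddBelow (Set.range μ) := ⟨0, by rintro _ ⟨n, rfl⟩; exact (h.pos n).le⟩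
  have hlim := tendsto_atTop_ciInf h.antitone hbdd
  set c := ⨅ n, μ n with hc
  have hcle : ∀ n, c ≤ μ n := fun n => ciInf_le hbdd n
  have hc0 : 0 ≤ c := le_ciInf fun n => (h.pos n).le
  rcases hc0.eq_or_lt with h0 | h0
  · rwa [← h0] at hlim
  exfalso
  obtain ⟨w, φ, hφ, hw⟩ := exists_subseq_tendsto T hT (u := e) (R := 1)
    fun n => (h.orthonormal.1 n).le
  obtain ⟨N, hN⟩ := Metric.cauchySeq_iff.mp hw.cauchySeq c h0
  have h1 := hN N le_rfl (N + 1) (by omega)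
  have hne : φ N ≠ φ (N + 1) := (hφ (Nat.lt_succ_self N)).ne
  rw [dist_eq_norm, h.eigen, h.eigen] at h1
  have h2 : ‖μ (φ N) • e (φ N) - μ (φ (N + 1)) • e (φ (N + 1))‖ ^ 2
      = μ (φ N) ^ 2 + μ (φ (N + 1)) ^ 2 := by
    rw [norm_sub_sq_real, norm_smul, norm_smul, h.orthonormal.1, h.orthonormal.1,
      inner_smul_left, inner_smul_right, h.orthonormal.2 hne]
    simp
  have h3 := hcle (φ N)
  have h4 : ‖μ (φ N) • e (φ N) - μ (φ (N + 1)) • e (φ (N + 1))‖ ^ 2 < c ^ 2 := by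
    gcongr
  nlinarith [sq_nonneg (μ (φ (N + 1)))]

/-- Since e_n is orthogonal to the invariant span of its predecessors, the form splits at v + c e_n
into its value at v and c²μ_n; induction and monotonicity of μ finish. -/
theorem ge_of_mem_span (h : IsPosEigenSeq T e μ) (n : ℕ) :
    ∀ u ∈ Submodule.span ℝ (e '' Set.Iio (n + 1)), μ n * ‖u‖ ^ 2 ≤ ⟪T u, u⟫ := by
  have hsplit : ∀ n, Submodule.span ℝ (e '' Set.Iio (n + 1))
      = Submodule.span ℝ (e '' Set.Iio n) ⊔ Submodule.span ℝ {e n} := by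
    intro n
    have : Set.Iio (n + 1) = Set.Iio n ∪ {n} := by ext i; simp
    rw [this, Set.image_union, Submodule.span_union, Set.image_singleton]
  have hinv : ∀ n, ∀ u ∈ Submodule.span ℝ (e '' Set.Iio n),
      T u ∈ Submodule.span ℝ (e '' Set.Iio n) := by
    intro n
    have : Submodule.span ℝ (e '' Set.Iio n)
        ≤ (Submodule.span ℝ (e '' Set.Iio n)).comap (T : H →ₗ[ℝ] H) := by
      rw [Submodule.span_le]
      rintro _ ⟨i, hi, rfl⟩
      rw [SetLike.mem_coe, Submodule.mem_comap, ContinuousLinearMap.coe_coe, h.eigen]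
      exact Submodule.smul_mem _ _ (Submodule.subset_span ⟨i, hi, rfl⟩)
    exact this
  have hstep : ∀ n, (∀ u ∈ Submodule.span ℝ (e '' Set.Iio n), μ n * ‖u‖ ^ 2 ≤ ⟪T u, u⟫) →
      ∀ u ∈ Submodule.span ℝ (e '' Set.Iio (n + 1)), μ n * ‖u‖ ^ 2 ≤ ⟪T u, u⟫ := by
    intro n ih u hu
    rw [hsplit, Submodule.mem_sup] at hu
    obtain ⟨v, hv, w, hw, rfl⟩ := hu
    obtain ⟨c, rfl⟩ := Submodule.mem_span_singleton.mp hw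
    have ho : ∀ x ∈ Submodule.span ℝ (e '' Set.Iio n), ⟪x, e n⟫ = 0 :=
      fun x hx => (Submodule.mem_orthogonal _ _).mp (h.mem_orthogonal le_rfl) x hx
    have h1 := ho v hv
    have h2 := ho _ (hinv n v hv)
    have h3 := ih v hv
    have h4 : ⟪e n, v⟫ = 0 := by rw [real_inner_comm]; exact h1
    rw [norm_add_sq_real, inner_smul_right, h1, norm_smul, h.orthonormal.1, map_add, map_smul,
      h.eigen]
    simp only [inner_add_left, inner_add_right, inner_smul_left, inner_smul_right, h2, h4,
      real_inner_self_eq_norm_sq, h.orthonormal.1, conj_trivial, Real.norm_eq_abs, mul_one, sq_abs]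
    nlinarith
  induction n with
  | zero => exact hstep 0 (by simp)
  | succ n ih =>
    refine hstep (n + 1) fun u hu => le_trans ?_ (ih u hu)
    gcongr
    exact h.antitone (Nat.le_succ n)

end IsPosEigenSeq

/-- Positivity of a continuous quadratic form on a subspace passes to a subspace of the same
dimension inside a dense subspace. -/
theorem exists_positive_of_dense {E : Type*} [NormedAddCommGroup E] [NormedSpace ℝ E]
    {D : Set E} (hD : Dense D) {q : E → ℝ} (hq : Continuous q)
    (hq2 : ∀ (c : ℝ) u, q (c • u) = c ^ 2 * q u) {k : ℕ}
    (f : Fin k → E) (hf : ∀ c : Fin k → ℝ, c ≠ 0 → 0 < q (∑ i, c i • f i)) :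
    ∃ g : Fin k → E, (∀ i, g i ∈ D) ∧ ∀ c : Fin k → ℝ, c ≠ 0 → 0 < q (∑ i, c i • g i) := by
  let Φ : (Fin k → ℝ) × (Fin k → E) → ℝ := fun p => q (∑ i, p.1 i • p.2 i)
  have hΦ : Continuous Φ := by
    refine hq.comp ?_
    fun_prop
  have hopen : IsOpen (Φ ⁻¹' Set.Ioi 0) := isOpen_Ioi.preimage hΦ
  -- Positivity is an open condition in (coefficients, vectors), and the unit sphere of coefficients
  -- is compact, so it persists for all vectors in a neighbourhood of `f`. Homogeneity then removes
  -- the normalization.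
  obtain ⟨U, V, -, hV, hU', hV', hUV⟩ := generalized_tube_lemma
    (isCompact_sphere (0 : Fin k → ℝ) 1) (isCompact_singleton (x := f)) hopen (by
      rintro ⟨c, w⟩ ⟨hc, hw⟩
      rw [Set.mem_singleton_iff] at hw
      simp only at hw hc
      subst hw
      exact hf c (by rintro rfl; simp at hc))
  have hDk : Dense {g : Fin k → E | ∀ i, g i ∈ D} := by
    have := dense_pi Set.univ (s := fun _ : Fin k => D) fun _ _ => hD
    convert this using 1
    ext g; simp
  obtain ⟨g, hgV, hgD⟩ := hDk.exists_mem_open hV ⟨f, hV' rfl⟩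
  refine ⟨g, hgV, fun c hc => ?_⟩
  have hn : ‖c‖ ≠ 0 := norm_ne_zero_iff.mpr hc
  have h1 : (‖c‖⁻¹ • c, g) ∈ Φ ⁻¹' Set.Ioi 0 :=
    hUV ⟨hU' (by simp [norm_smul, hn]), hgD⟩
  have h2 : 0 < q (∑ i, (‖c‖⁻¹ • c) i • g i) := h1
  have h3 : ∑ i, (‖c‖⁻¹ • c) i • g i = ‖c‖⁻¹ • ∑ i, c i • g i := by
    rw [Finset.smul_sum]
    simp [smul_smul]
  rw [h3, hq2] at h2
  exact (pos_iff_pos_of_mul_pos h2).mp (by positivity)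

end CompactSymmetric

namespace NonlocalEig

/-! ### X_K(Ω) as a Hilbert space: Poincaré inequality and completeness. -/

variable {N : ℕ}

theorem AdmissibleKernel.dim_pos (K : AdmissibleKernel N) : 0 < N := by
  obtain ⟨_, s, _, hs, _, hN, _⟩ := K.lower_bound
  have : (0 : ℝ) < N := by linarith
  exact_mod_cast this

theorem aemeasurable_diff {u : Euc N → ℝ} (hu : AEMeasurable u volume) :
    AEMeasurable (fun p : Euc N × Euc N => u p.1 - u p.2) (volume.prod volume) :=
  (hu.comp_quasiMeasurePreserving Measure.quasiMeasurePreserving_fst).sub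
    (hu.comp_quasiMeasurePreserving Measure.quasiMeasurePreserving_snd)

theorem aemeasurable_energy (K : AdmissibleKernel N) {u : Euc N → ℝ} (hu : AEMeasurable u volume) :
    AEMeasurable (fun p : Euc N × Euc N =>
      ENNReal.ofReal ((u p.1 - u p.2) ^ 2 * K.toFun (p.1 - p.2))) (volume.prod volume) :=
  (((aemeasurable_diff hu).pow_const 2).mul K.aemeasurable_sub).ennreal_ofReal

theorem integrable_energy (K : AdmissibleKernel N) {u : Euc N → ℝ} (hu : AEMeasurable u volume)
    (h : energy K u < ⊤) :
    Integrable (fun p : Euc N × Euc N => (u p.1 - u p.2) ^ 2 * K.toFun (p.1 - p.2))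
      (volume.prod volume) := by
  refine ⟨(((aemeasurable_diff hu).pow_const 2).mul K.aemeasurable_sub).aestronglyMeasurable, ?_⟩
  rw [hasFiniteIntegral_iff_ofReal]
  · exact h
  · filter_upwards [ae_sub_ne_zero K] with p hp
    exact mul_nonneg (sq_nonneg _) (K.nonneg hp)

theorem integrable_kInner (K : AdmissibleKernel N) {u v : Euc N → ℝ} (hu : AEMeasurable u volume)
    (hv : AEMeasurable v volume) (h : energy K u < ⊤) (h' : energy K v < ⊤) :
    Integrable (fun p : Euc N × Euc N => (u p.1 - u p.2) * (v p.1 - v p.2) * K.toFun (p.1 - p.2))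
      (volume.prod volume) := by
  refine ((integrable_energy K hu h).add (integrable_energy K hv h')).mono'
    (((aemeasurable_diff hu).mul (aemeasurable_diff hv)).mul
      K.aemeasurable_sub).aestronglyMeasurable ?_
  filter_upwards [ae_sub_ne_zero K] with p hp
  have hK := K.nonneg hp
  rw [Real.norm_eq_abs, abs_mul, abs_of_nonneg hK, Pi.add_apply, ← add_mul]
  refine mul_le_mul_of_nonneg_right ?_ hK
  rw [abs_le]
  constructor <;> nlinarith [sq_nonneg ((u p.1 - u p.2) - (v p.1 - v p.2)),
    sq_nonneg ((u p.1 - u p.2) + (v p.1 - v p.2))]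

theorem kInner_self_nonneg (K : AdmissibleKernel N) (u : Euc N → ℝ) : 0 ≤ kInner K u u := by
  refine integral_nonneg_of_ae ?_
  filter_upwards [ae_sub_ne_zero K] with p hp
  exact mul_nonneg (mul_self_nonneg _) (K.nonneg hp)

theorem ofReal_kInner_self (K : AdmissibleKernel N) {u : Euc N → ℝ} (hu : AEMeasurable u volume)
    (h : energy K u < ⊤) : ENNReal.ofReal (kInner K u u) = energy K u := by
  unfold kInner energy
  simp_rw [← sq]
  refine ofReal_integral_eq_lintegral_ofReal (integrable_energy K hu h) ?_
  filter_upwards [ae_sub_ne_zero K] with p hp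
  exact mul_nonneg (sq_nonneg _) (K.nonneg hp)

/-- The power in the lower bound decreases with the distance, so its value at distance d serves for
all shorter ones. -/
theorem exists_kernel_lower_bound (K : AdmissibleKernel N) :
    ∃ α s : ℝ, 0 < α ∧ 0 < s ∧ ∀ (d : ℝ) (x : Euc N), x ≠ 0 → ‖x‖ ≤ d →
      α * d ^ (-((N : ℝ) + 2 * s)) ≤ K.toFun x := by
  obtain ⟨α, s, hα, hs, _, _, h⟩ := K.lower_bound
  refine ⟨α, s, hα, hs, fun d x hx hd => le_trans ?_ (h x hx)⟩
  refine mul_le_mul_of_nonneg_left (Real.rpow_le_rpow_of_nonpos (norm_pos_iff.mpr hx) hd ?_) hα.le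
  have : (0 : ℝ) ≤ N := Nat.cast_nonneg N
  linarith

theorem lintegral_sq_eq (u : Lp ℝ 2 (volume : Measure (Euc N))) :
    ∫⁻ x, ENNReal.ofReal ((u x) ^ 2) = ENNReal.ofReal (‖u‖ ^ 2) := by
  have h1 : ‖u‖ ^ 2 = ∫ x, (u x) ^ 2 := by
    rw [← real_inner_self_eq_norm_sq, L2.inner_def]
    simp [sq]
  rw [h1, ofReal_integral_eq_lintegral_ofReal (Lp.memLp u).integrable_sq]
  exact Eventually.of_forall fun x => sq_nonneg _

/-- The Poincaré inequality on a bounded set. -/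
theorem exists_poincare (K : AdmissibleKernel N) {Ω : Set (Euc N)} (hb : Bornology.IsBounded Ω) :
    ∃ C : ℝ, 0 < C ∧ ∀ u : XK K Ω, ‖(u : Lp ℝ 2 (volume : Measure (Euc N)))‖ ^ 2 ≤
      C * ip K Ω u u := by
  obtain ⟨α, s, hα, hs, hK⟩ := exists_kernel_lower_bound K
  obtain ⟨R, hR0, hR⟩ := hb.subset_ball_lt 0 (0 : Euc N)
  have : Nonempty (Fin N) := ⟨⟨0, K.dim_pos⟩⟩
  -- The unit ball B around z misses the ball A that contains Ω, so u = 0 a.e. on B. The pairs in Ω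
  -- × B alone bound the energy from below, and their distance is at most R + (R + 1) + 1 = 2R + 2.
  obtain ⟨z, hz⟩ := exists_norm_eq (Euc N) (show 0 ≤ R + 1 by linarith)
  set B := Metric.ball z 1 with hB
  set A := Metric.ball (0 : Euc N) R with hA
  have hdisj : ∀ y ∈ B, y ∉ A := by
    intro y hy hy'
    rw [hB, Metric.mem_ball, dist_eq_norm] at hy
    rw [hA, mem_ball_zero_iff] at hy'
    have := norm_sub_norm_le z y
    rw [norm_sub_rev] at this
    linarith
  set c := α * (2 * R + 2) ^ (-((N : ℝ) + 2 * s)) with hc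
  have hcpos : 0 < c := by positivity
  have hvB : 0 < volume B := Metric.measure_ball_pos _ _ one_pos
  have hvB' : volume B ≠ ⊤ := measure_ball_lt_top.ne
  have hv : 0 < (volume B).toReal := ENNReal.toReal_pos hvB.ne' hvB'
  refine ⟨(c * (volume B).toReal)⁻¹, by positivity, fun u => ?_⟩
  obtain ⟨hue, hu0⟩ := u.2
  set f : Euc N → ℝ := ((u : Lp ℝ 2 (volume : Measure (Euc N))) : Euc N → ℝ) with hf
  have hfm : AEMeasurable f volume :=
    (Lp.aestronglyMeasurable (u : Lp ℝ 2 (volume : Measure (Euc N)))).aemeasurable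
  have hlow : ENNReal.ofReal (‖(u : Lp ℝ 2 (volume : Measure (Euc N)))‖ ^ 2) *
      ENNReal.ofReal (c * (volume B).toReal) ≤ energy K f := by
    rw [← lintegral_sq_eq]
    have h1 : energy K f ≥ ∫⁻ p : Euc N × Euc N, ENNReal.ofReal ((f p.1) ^ 2) *
        B.indicator (fun _ => ENNReal.ofReal c) p.2 ∂(volume.prod volume) := by
      refine lintegral_mono_ae ?_
      filter_upwards [ae_sub_ne_zero K, Measure.quasiMeasurePreserving_fst.ae hu0,
        Measure.quasiMeasurePreserving_snd.ae hu0] with p hp h1 h2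
      by_cases hy : p.2 ∈ B
      · rw [Set.indicator_of_mem hy]
        have h3 : f p.2 = 0 := h2 fun hΩ => hdisj _ hy (hR hΩ)
        by_cases hx : p.1 ∈ Ω
        · rw [h3, sub_zero, ← ENNReal.ofReal_mul (sq_nonneg _)]
          refine ENNReal.ofReal_le_ofReal (mul_le_mul_of_nonneg_left ?_ (sq_nonneg _))
          refine hK _ _ hp ?_
          have hx' := hR hx
          rw [mem_ball_zero_iff] at hx'
          have hy' := hy
          rw [hB, Metric.mem_ball, dist_eq_norm] at hy'
          calc ‖p.1 - p.2‖ = ‖p.1 - z - (p.2 - z)‖ := by congr 1; abel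
            _ ≤ ‖p.1 - z‖ + ‖p.2 - z‖ := norm_sub_le _ _
            _ ≤ ‖p.1‖ + ‖z‖ + ‖p.2 - z‖ := by gcongr; exact norm_sub_le _ _
            _ ≤ 2 * R + 2 := by linarith
        · have : f p.1 = 0 := h1 hx
          simp [this]
      · rw [Set.indicator_of_notMem hy]; simp
    refine le_trans (le_of_eq ?_) h1
    rw [lintegral_prod_mul (f := fun x => ENNReal.ofReal ((f x) ^ 2))
      (g := B.indicator (fun _ => ENNReal.ofReal c)) (by fun_prop)
      ((measurable_const.indicator measurableSet_ball).aemeasurable),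
      lintegral_indicator_const measurableSet_ball, ENNReal.ofReal_mul hcpos.le,
      ENNReal.ofReal_toReal hvB']
  rw [← ofReal_kInner_self K hfm hue, ← ENNReal.ofReal_mul (by positivity),
    ENNReal.ofReal_le_ofReal_iff (kInner_self_nonneg K f)] at hlow
  rw [inv_mul_eq_div, le_div_iff₀ (by positivity)]
  exact hlow

theorem kInner_add_left (K : AdmissibleKernel N) {u v w : Euc N → ℝ} (hu : AEMeasurable u volume)
    (hv : AEMeasurable v volume) (hw : AEMeasurable w volume) (h : energy K u < ⊤)
    (h' : energy K v < ⊤) (h'' : energy K w < ⊤) :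
    kInner K (u + v) w = kInner K u w + kInner K v w := by
  unfold kInner
  rw [← integral_add (integrable_kInner K hu hw h h'') (integrable_kInner K hv hw h' h'')]
  congr 1
  ext p
  simp only [Pi.add_apply]
  ring

theorem kInner_smul_left (K : AdmissibleKernel N) (c : ℝ) (u v : Euc N → ℝ) :
    kInner K (c • u) v = c * kInner K u v := by
  unfold kInner
  rw [← integral_const_mul]
  congr 1
  ext p
  simp only [Pi.smul_apply, smul_eq_mul]
  ring

theorem kInner_comm (K : AdmissibleKernel N) (u v : Euc N → ℝ) : kInner K u v = kInner K v u := by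
  unfold kInner
  congr 1
  ext p
  ring

theorem XK.aemeasurable {K : AdmissibleKernel N} {Ω : Set (Euc N)} (u : XK K Ω) :
    AEMeasurable ((u : Lp ℝ 2 (volume : Measure (Euc N))) : Euc N → ℝ) volume :=
  (Lp.aestronglyMeasurable (u : Lp ℝ 2 (volume : Measure (Euc N)))).aemeasurable

/-- `X_K(Ω)` as a Hilbert space, for the scalar product `ip`. -/
def HK (K : AdmissibleKernel N) (Ω : Set (Euc N)) (_ : Bornology.IsBounded Ω) : Type := XK K Ω

variable (K : AdmissibleKernel N) (Ω : Set (Euc N)) (hb : Bornology.IsBounded Ω)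

noncomputable instance : AddCommGroup (HK K Ω hb) := inferInstanceAs (AddCommGroup (XK K Ω))

noncomputable instance : Module ℝ (HK K Ω hb) := inferInstanceAs (Module ℝ (XK K Ω))

/-- The inner product space core given by `ip`. -/
@[reducible] noncomputable def hkCore : InnerProductSpace.Core ℝ (HK K Ω hb) where
  inner u v := ip K Ω u v
  conj_inner_symm u v := kInner_comm K _ _
  re_inner_nonneg u := kInner_self_nonneg K _
  add_left u v w := by
    let u' : XK K Ω := u
    let v' : XK K Ω := v
    let w' : XK K Ω := w
    change ip K Ω (u' + v') w' = ip K Ω u' w' + ip K Ω v' w'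
    unfold ip
    rw [← kInner_add_left K (XK.aemeasurable u') (XK.aemeasurable v') (XK.aemeasurable w') u'.2.1 v'.2.1 w'.2.1]
    exact kInner_congr K (Lp.coeFn_add _ _) (ae_eq_refl _)
  smul_left u v r := by
    let u' : XK K Ω := u
    let v' : XK K Ω := v
    change ip K Ω (r • u') v' = r * ip K Ω u' v'
    unfold ip
    rw [← kInner_smul_left]
    exact kInner_congr K (Lp.coeFn_smul _ _) (ae_eq_refl _)
  definite u h := by
    let u' : XK K Ω := u
    change ip K Ω u' u' = 0 at h
    change u' = 0
    obtain ⟨C, -, hC⟩ := exists_poincare K hb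
    have := hC u'
    rw [h, mul_zero] at this
    have h0 : ‖(u' : Lp ℝ 2 (volume : Measure (Euc N)))‖ = 0 := by
      nlinarith [norm_nonneg (u' : Lp ℝ 2 (volume : Measure (Euc N)))]
    exact Subtype.ext (norm_eq_zero.mp h0)

noncomputable instance : NormedAddCommGroup (HK K Ω hb) := (hkCore K Ω hb).toNormedAddCommGroup

noncomputable instance : InnerProductSpace ℝ (HK K Ω hb) := InnerProductSpace.ofCore (hkCore K Ω hb).toCore

/-- The inclusion of `X_K(Ω)` in `L²`, as a linear map on `HK`. -/
noncomputable def HK.toLpₗ : HK K Ω hb →ₗ[ℝ] Lp ℝ 2 (volume : Measure (Euc N)) := (XK K Ω).subtype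

variable {K Ω hb}

theorem HK.norm_sq (u : HK K Ω hb) : ‖u‖ ^ 2 = ip K Ω u u := by
  rw [← real_inner_self_eq_norm_sq]; rfl

variable (K Ω hb)

theorem HK.exists_norm_le : ∃ C : ℝ, 0 ≤ C ∧ ∀ u : HK K Ω hb, ‖HK.toLpₗ K Ω hb u‖ ≤ C * ‖u‖ := by
  obtain ⟨C, hC0, hC⟩ := exists_poincare K hb
  refine ⟨Real.sqrt C, Real.sqrt_nonneg _, fun u => ?_⟩
  refine abs_le_of_sq_le_sq' ?_ (by positivity) |>.2
  rw [mul_pow, Real.sq_sqrt hC0.le, HK.norm_sq]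
  exact hC u

/-- The inclusion of `X_K(Ω)` in `L²`. -/
noncomputable def HK.toLp : HK K Ω hb →L[ℝ] Lp ℝ 2 (volume : Measure (Euc N)) :=
  (HK.toLpₗ K Ω hb).mkContinuousOfExistsBound (by
    obtain ⟨C, _, h⟩ := HK.exists_norm_le K Ω hb
    exact ⟨C, h⟩)

theorem HK.toLp_mem (u : HK K Ω hb) : HK.toLp K Ω hb u ∈ XK K Ω := (show XK K Ω from u).2

theorem HK.ofReal_norm_sq (u : HK K Ω hb) :
    ENNReal.ofReal (‖u‖ ^ 2) = energy K (HK.toLp K Ω hb u) := by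
  rw [HK.norm_sq]
  exact ofReal_kInner_self K (XK.aemeasurable (show XK K Ω from u)) (HK.toLp_mem K Ω hb u).1

/-- Fatou's lemma on the product space. -/
theorem energy_le_liminf {f : ℕ → Euc N → ℝ} {g : Euc N → ℝ} (hf : ∀ n, AEMeasurable (f n) volume)
    (h : ∀ᵐ x ∂(volume : Measure (Euc N)), Tendsto (fun n => f n x) atTop (𝓝 (g x))) :
    energy K g ≤ liminf (fun n => energy K (f n)) atTop := by
  refine le_trans (lintegral_mono_ae ?_)
    (lintegral_liminf_le' fun n => aemeasurable_energy K (hf n))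
  filter_upwards [Measure.quasiMeasurePreserving_fst.ae h,
    Measure.quasiMeasurePreserving_snd.ae h] with p h1 h2
  refine le_of_eq (Tendsto.liminf_eq ?_).symm
  exact (ENNReal.continuous_ofReal.tendsto _).comp (((h1.sub h2).pow 2).mul_const _)

/-- By the Poincaré inequality a Cauchy sequence converges in L², hence a.e. along a subsequence.
Lower semicontinuity of the energy of u_n - u_{φ(k)} as k → ∞ then bounds the energy of u_n minus
the limit; this shows both that the limit lies in X_K(Ω) and that convergence holds in norm. -/
instance : CompleteSpace (HK K Ω hb) := by
  refine Metric.complete_of_cauchySeq_tendsto fun u hu => ?_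
  have hc : CauchySeq (fun n => HK.toLp K Ω hb (u n)) :=
    (HK.toLp K Ω hb).uniformContinuous.comp_cauchySeq hu
  obtain ⟨f, hf⟩ := cauchySeq_tendsto_of_complete hc
  obtain ⟨φ, hφ, hae⟩ := (tendstoInMeasure_of_tendsto_Lp hf).exists_seq_tendsto_ae
  have hest : ∀ ε > 0, ∃ M, ∀ n ≥ M,
      energy K ((HK.toLp K Ω hb (u n) : Euc N → ℝ) - f) ≤ ENNReal.ofReal (ε ^ 2) := by
    intro ε hε
    obtain ⟨M, hM⟩ := Metric.cauchySeq_iff.mp hu ε hε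
    refine ⟨M, fun n hn => ?_⟩
    refine (energy_le_liminf K
      (f := fun k => (HK.toLp K Ω hb (u n) : Euc N → ℝ) - HK.toLp K Ω hb (u (φ k)))
      (fun k => ((Lp.aestronglyMeasurable _).sub (Lp.aestronglyMeasurable _)).aemeasurable) ?_).trans ?_
    · filter_upwards [hae] with x hx
      exact hx.const_sub _
    · refine liminf_le_of_frequently_le' (Eventually.frequently ?_)
      filter_upwards [hφ.tendsto_atTop.eventually_ge_atTop M] with k hk
      have h1 := hM n hn (φ k) hk
      rw [dist_eq_norm] at h1
      rw [← energy_congr K (Lp.coeFn_sub _ _), ← map_sub, ← HK.ofReal_norm_sq]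
      exact ENNReal.ofReal_le_ofReal (by gcongr)
  have hfX : f ∈ XK K Ω := by
    obtain ⟨M, hM⟩ := hest 1 one_pos
    have h1 := (hM M le_rfl).trans_lt ENNReal.ofReal_lt_top
    refine ⟨?_, ?_⟩
    · have h2 := energy_smul_lt_top K (-1) h1
      have h3 := energy_add_lt_top K (u := (HK.toLp K Ω hb (u M) : Euc N → ℝ))
        (Lp.aestronglyMeasurable _).aemeasurable (HK.toLp_mem K Ω hb (u M)).1 h2
      convert h3 using 2
      ext x; simp
    · have h2 : ∀ᵐ x ∂(volume : Measure (Euc N)), ∀ n, x ∉ Ω → HK.toLp K Ω hb (u n) x = 0 :=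
        ae_all_iff.mpr fun n => (HK.toLp_mem K Ω hb (u n)).2
      filter_upwards [hae, h2] with x hx h3 hΩ
      exact tendsto_nhds_unique hx (tendsto_const_nhds.congr fun n => (h3 _ hΩ).symm)
  let g : HK K Ω hb := (⟨f, hfX⟩ : XK K Ω)
  refine ⟨g, Metric.tendsto_atTop.mpr fun ε hε => ?_⟩
  obtain ⟨M, hM⟩ := hest (ε / 2) (by positivity)
  refine ⟨M, fun n hn => ?_⟩
  have h1 := hM n hn
  have h2 : energy K ((HK.toLp K Ω hb (u n) : Euc N → ℝ) - f) = ENNReal.ofReal (‖u n - g‖ ^ 2) := by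
    rw [HK.ofReal_norm_sq, map_sub]
    exact (energy_congr K (Lp.coeFn_sub _ _)).symm
  rw [h2, ENNReal.ofReal_le_ofReal_iff (by positivity)] at h1
  rw [dist_eq_norm]
  have := abs_le_of_sq_le_sq' h1 (by positivity)
  linarith [this.2]

end NonlocalEig

namespace NonlocalEig

/-! ### Averaging over cubes and the compact embedding in L². -/

section Averaging

variable {X : Type*} [MeasurableSpace X] {m : Measure X}

theorem integrable_sub_sq_prod [SFinite m] {Q : Set X} (hQ : m Q ≠ ⊤) {f : X → ℝ} (hf : MemLp f 2 m) :
    IntegrableOn (fun p : X × X => (f p.1 - f p.2) ^ 2) (Q ×ˢ Q) (m.prod m) := by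
  have : IsFiniteMeasure (m.restrict Q) := ⟨by simpa using hQ.lt_top⟩
  have hfQ := hf.restrict Q
  rw [IntegrableOn, ← Measure.prod_restrict]
  exact ((hfQ.comp_fst _).sub (hfQ.comp_snd _)).integrable_sq

theorem setIntegral_sub_sq_prod [SFinite m] {Q : Set X} (hQ : m Q ≠ ⊤) {f : X → ℝ} (hf : MemLp f 2 m) :
    ∫ p in Q ×ˢ Q, (f p.1 - f p.2) ^ 2 ∂(m.prod m)
      = 2 * (m.real Q * ∫ x in Q, f x ^ 2 ∂m) - 2 * (∫ x in Q, f x ∂m) ^ 2 := by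
  have : IsFiniteMeasure (m.restrict Q) := ⟨by simpa using hQ.lt_top⟩
  have hfQ := hf.restrict Q
  have h2 := hfQ.integrable_sq
  have h1 : Integrable f (m.restrict Q) := hfQ.integrable (by norm_num)
  rw [← Measure.prod_restrict]
  have e : ∀ p : X × X, (f p.1 - f p.2) ^ 2 = f p.1 ^ 2 + f p.2 ^ 2 - 2 * (f p.1 * f p.2) :=
    fun p => by ring
  simp_rw [e]
  have i1 := h2.comp_fst (m.restrict Q)
  have i2 := h2.comp_snd (m.restrict Q)
  have i3 := (h1.mul_prod h1).const_mul 2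
  rw [integral_sub (f := fun p : X × X => f p.1 ^ 2 + f p.2 ^ 2) (i1.add i2) i3,
    integral_add i1 i2, integral_const_mul, integral_prod_mul,
    integral_fun_fst (fun x => f x ^ 2), integral_fun_snd (fun x => f x ^ 2)]
  simp only [measureReal_restrict_apply_univ, smul_eq_mul]
  ring

variable {ι : Type*} (S : Finset ι) {Q : ι → Set X} (hQm : ∀ i, MeasurableSet (Q i))
  (hQf : ∀ i, m (Q i) ≠ ⊤)

/-- Replacing a function by its averages over the sets `Q i`, `i ∈ S`, all of measure `v`. -/
noncomputable def averaging (v : ℝ) : Lp ℝ 2 m →L[ℝ] Lp ℝ 2 m :=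
  ∑ i ∈ S, (innerSL ℝ (indicatorConstLp 2 (hQm i) (hQf i) (1 : ℝ))).smulRight
    (v⁻¹ • indicatorConstLp 2 (hQm i) (hQf i) (1 : ℝ))

theorem isCompactOperator_smulRight {E F : Type*} [NormedAddCommGroup E] [NormedSpace ℝ E]
    [NormedAddCommGroup F] [NormedSpace ℝ F] (l : E →L[ℝ] ℝ) (y : F) :
    IsCompactOperator (l.smulRight y) := by
  have h : IsCompactOperator (l : E → ℝ) :=
    isCompactOperator_of_locallyCompactSpace_dom l
  exact h.clm_comp (ContinuousLinearMap.toSpanSingleton ℝ y)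

theorem isCompactOperator_averaging (v : ℝ) :
    IsCompactOperator (averaging S hQm hQf v : Lp ℝ 2 m → Lp ℝ 2 m) := by
  have : averaging S hQm hQf v ∈ compactOperator (RingHom.id ℝ) (Lp ℝ 2 m) (Lp ℝ 2 m) :=
    Submodule.sum_mem _ fun i _ => isCompactOperator_smulRight _ _
  exact this

/-- A variance identity on each set: the squared L² distance to the mean is the double integral of
the squared differences divided by twice the measure. Disjointness makes the contributions add up,
and u vanishes outside the sets used. -/
theorem norm_sub_averaging_sq [SFinite m]
    (hd : Pairwise (Function.onFun Disjoint Q)) {v : ℝ} (hv : 0 < v)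
    (hQv : ∀ i, m.real (Q i) = v) (u : Lp ℝ 2 m) (hu : ∀ᵐ x ∂m, x ∉ ⋃ i ∈ S, Q i → u x = 0) :
    ‖u - averaging S hQm hQf v u‖ ^ 2
      = (2 * v)⁻¹ * ∑ i ∈ S, ∫ p in Q i ×ˢ Q i, (u p.1 - u p.2) ^ 2 ∂(m.prod m) := by
  classical
  set g : ι → Lp ℝ 2 m := fun i => indicatorConstLp 2 (hQm i) (hQf i) (1 : ℝ) with hg
  have hgg : ∀ i j, inner ℝ (g i) (g j) = if i = j then v else 0 := by
    intro i j
    rw [hg, L2.real_inner_indicatorConstLp_one_indicatorConstLp_one (hQm i) (hQm j) (hQf i) (hQf j)]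
    split_ifs with h
    · rw [h, Set.inter_self, hQv]
    · rw [(hd h).inter_eq]; simp
  have hgu : ∀ i, inner ℝ (g i) u = ∫ x in Q i, u x ∂m := fun i =>
    L2.inner_indicatorConstLp_one (hQm i) (hQf i) u
  have hA : averaging S hQm hQf v u = ∑ i ∈ S, (v⁻¹ * inner ℝ (g i) u) • g i := by
    simp [averaging, hg, smul_smul, mul_comm]
  have h1 : inner ℝ u (averaging S hQm hQf v u) = ∑ i ∈ S, v⁻¹ * inner ℝ (g i) u ^ 2 := by
    rw [hA, inner_sum]
    refine Finset.sum_congr rfl fun i _ => ?_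
    rw [inner_smul_right, real_inner_comm]; ring
  have h2 : ‖averaging S hQm hQf v u‖ ^ 2 = ∑ i ∈ S, v⁻¹ * inner ℝ (g i) u ^ 2 := by
    rw [← real_inner_self_eq_norm_sq, hA, inner_sum]
    refine Finset.sum_congr rfl fun i hi => ?_
    rw [inner_smul_right, sum_inner]
    simp only [inner_smul_left, hgg, conj_trivial, mul_ite, mul_zero]
    rw [Finset.sum_ite_eq' S i, if_pos hi]
    field_simp
  have h3 : ‖u‖ ^ 2 = ∑ i ∈ S, ∫ x in Q i, u x ^ 2 ∂m := by
    have hi := (Lp.memLp u).integrable_sq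
    rw [← integral_biUnion_finset S (fun i _ => hQm i) (fun i _ j _ hij => hd hij)
      (fun i _ => hi.integrableOn), setIntegral_eq_integral_of_ae_compl_eq_zero,
      ← real_inner_self_eq_norm_sq, L2.inner_def]
    · simp [sq]
    · filter_upwards [hu] with x hx h
      rw [hx h]; simp
  rw [norm_sub_sq_real, h1, h2, h3, Finset.mul_sum, Finset.mul_sum, ← Finset.sum_sub_distrib,
    ← Finset.sum_add_distrib]
  refine Finset.sum_congr rfl fun i _ => ?_
  rw [setIntegral_sub_sq_prod (hQf i) (Lp.memLp u), hQv, hgu]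
  field_simp
  ring

end Averaging

variable {N : ℕ}

/-- The half-open cubes of side `1 / n`. -/
def cube (n : ℕ) (ν : Fin N → ℤ) : Set (Euc N) := {x | ∀ i, ⌊(n : ℝ) * x i⌋ = ν i}

theorem measurableSet_cube (n : ℕ) (ν : Fin N → ℤ) : MeasurableSet (cube n ν) := by
  have : cube n ν = ⋂ i, {x : Euc N | ⌊(n : ℝ) * x i⌋ = ν i} := by ext; simp [cube]
  rw [this]
  refine MeasurableSet.iInter fun i => ?_
  have h : Measurable fun x : Euc N => ⌊(n : ℝ) * x i⌋ := by fun_prop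
  exact h (measurableSet_singleton _)

theorem pairwise_disjoint_cube (n : ℕ) :
    Pairwise (Function.onFun Disjoint (cube n : (Fin N → ℤ) → Set (Euc N))) := by
  intro ν ν' h
  refine Set.disjoint_left.mpr fun x hx hx' => h ?_
  ext i
  rw [← hx i, ← hx' i]

theorem volume_cube {n : ℕ} (hn : 0 < n) (ν : Fin N → ℤ) :
    volume (cube n ν : Set (Euc N)) = ENNReal.ofReal (((n : ℝ)⁻¹) ^ N) := by
  have hn' : (0 : ℝ) < n := by exact_mod_cast hn
  have : (cube n ν : Set (Euc N)) = (WithLp.ofLp : Euc N → (Fin N → ℝ)) ⁻¹'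
      Set.pi Set.univ fun i => Set.Ico ((ν i : ℝ) / n) ((ν i + 1 : ℝ) / n) := by
    ext x
    simp only [cube, Set.mem_ofPred_eq, Set.mem_preimage, Set.mem_pi, Set.mem_univ, true_implies,
      Set.mem_Ico]
    refine forall_congr' fun i => ?_
    rw [Int.floor_eq_iff, div_le_iff₀ hn', lt_div_iff₀ hn', mul_comm]
  rw [this, (PiLp.volume_preserving_ofLp (Fin N)).measure_preimage
    (MeasurableSet.univ_pi fun i => measurableSet_Ico).nullMeasurableSet, Real.volume_pi_Ico]
  have e : ∀ i, (ν i + 1 : ℝ) / n - (ν i : ℝ) / n = (n : ℝ)⁻¹ := fun i => by field_simp; ring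
  simp only [e, Finset.prod_const, Finset.card_univ, Fintype.card_fin]
  rw [ENNReal.ofReal_pow (by positivity)]

theorem norm_sub_le_of_mem_cube {n : ℕ} (hn : 0 < n) {ν : Fin N → ℤ} {x y : Euc N}
    (hx : x ∈ cube n ν) (hy : y ∈ cube n ν) : ‖x - y‖ ≤ Real.sqrt N * (n : ℝ)⁻¹ := by
  have hn' : (0 : ℝ) < n := by exact_mod_cast hn
  rw [EuclideanSpace.norm_eq, Real.sqrt_le_left (by positivity), mul_pow,
    Real.sq_sqrt (Nat.cast_nonneg N)]
  have : ∀ i ∈ Finset.univ, ‖(x - y) i‖ ^ 2 ≤ ((n : ℝ)⁻¹) ^ 2 := by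
    intro i _
    have h1 := Int.floor_eq_iff.mp (hx i)
    have h2 := Int.floor_eq_iff.mp (hy i)
    gcongr
    rw [Real.norm_eq_abs, PiLp.sub_apply, ← mul_le_mul_iff_right₀ hn', ← abs_of_pos hn', ← abs_mul,
      abs_of_pos hn', mul_inv_cancel₀ hn'.ne', abs_le]
    constructor <;> linarith
  refine (Finset.sum_le_sum this).trans ?_
  simp

theorem exists_cover_cube {Ω : Set (Euc N)} (hb : Bornology.IsBounded Ω) (n : ℕ) :
    ∃ S : Finset (Fin N → ℤ), Ω ⊆ ⋃ ν ∈ S, cube n ν := by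
  obtain ⟨R, hR⟩ := hb.exists_norm_le
  set M : ℤ := ⌈(n : ℝ) * R⌉ with hM
  refine ⟨Fintype.piFinset fun _ => Finset.Icc (-M) M, fun x hx => ?_⟩
  simp only [Set.mem_iUnion]
  refine ⟨fun i => ⌊(n : ℝ) * x i⌋, ?_, fun i => rfl⟩
  rw [Fintype.mem_piFinset]
  intro i
  have h1 : |x i| ≤ R := (PiLp.norm_apply_le x i).trans (hR x hx)
  rw [abs_le] at h1
  have hn : (0 : ℝ) ≤ n := Nat.cast_nonneg n
  have h2 : (n : ℝ) * x i ≤ n * R := by gcongr; exact h1.2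
  have h3 : -(n * R) ≤ (n : ℝ) * x i := by nlinarith [h1.1]
  have h4 := Int.le_ceil ((n : ℝ) * R)
  rw [Finset.mem_Icc]
  constructor
  · rw [Int.le_floor]; push_cast; linarith
  · exact_mod_cast (Int.floor_le ((n : ℝ) * x i)).trans (h2.trans h4)

variable (K : AdmissibleKernel N) (Ω : Set (Euc N)) (hb : Bornology.IsBounded Ω)

/-- Two points of one cube are at most √N/n apart, so K ≥ c there; the sets Q × Q are disjoint for
distinct cubes Q, so together they carry at most the full energy. -/
theorem sum_setIntegral_le (u : XK K Ω) (S : Finset (Fin N → ℤ)) {n : ℕ} (hn : 0 < n) {c : ℝ}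
    (hc : ∀ x : Euc N, x ≠ 0 → ‖x‖ ≤ Real.sqrt N * (n : ℝ)⁻¹ → c ≤ K.toFun x) :
    c * ∑ ν ∈ S, ∫ p in cube n ν ×ˢ cube n ν, ((u : Lp ℝ 2 volume) p.1 - (u : Lp ℝ 2 volume) p.2) ^ 2
      ∂((volume : Measure (Euc N)).prod volume) ≤ ip K Ω u u := by
  set f : Euc N → ℝ := ((u : Lp ℝ 2 (volume : Measure (Euc N))) : Euc N → ℝ) with hf
  have hI := integrable_energy K (XK.aemeasurable u) u.2.1
  have hm : ∀ ν : Fin N → ℤ, MeasurableSet (cube n ν ×ˢ cube n ν : Set (Euc N × Euc N)) :=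
    fun ν => (measurableSet_cube n ν).prod (measurableSet_cube n ν)
  have hne := ae_sub_ne_zero K
  have h1 : ∀ ν ∈ S, c * ∫ p in cube n ν ×ˢ cube n ν, (f p.1 - f p.2) ^ 2
      ∂((volume : Measure (Euc N)).prod volume) ≤ ∫ p in cube n ν ×ˢ cube n ν,
        (f p.1 - f p.2) ^ 2 * K.toFun (p.1 - p.2) ∂((volume : Measure (Euc N)).prod volume) := by
    intro ν _
    rw [← integral_const_mul]
    refine integral_mono_ae ?_ hI.integrableOn ?_
    · exact (integrable_sub_sq_prod (by rw [volume_cube hn]; exact ENNReal.ofReal_ne_top)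
        (Lp.memLp (u : Lp ℝ 2 (volume : Measure (Euc N))))).const_mul c
    · filter_upwards [ae_restrict_mem (hm ν), ae_restrict_of_ae hne] with p hp h0
      rw [mul_comm]
      exact mul_le_mul_of_nonneg_left (hc _ h0 (norm_sub_le_of_mem_cube hn hp.1 hp.2))
        (sq_nonneg _)
  rw [Finset.mul_sum]
  refine (Finset.sum_le_sum h1).trans ?_
  rw [← integral_biUnion_finset S (fun ν _ => hm ν)
    (fun ν _ ν' _ h => Set.Disjoint.set_prod_left (pairwise_disjoint_cube n h) _ _)
    (fun ν _ => hI.integrableOn)]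
  refine (setIntegral_le_integral hI ?_).trans (le_of_eq ?_)
  · filter_upwards [hne] with p hp
    exact mul_nonneg (sq_nonneg _) (K.nonneg hp)
  · simp only [ip, kInner, sq]

theorem HK.exists_compact_approx : ∃ C s : ℝ, 0 ≤ C ∧ 0 < s ∧ ∀ n : ℕ, 0 < n →
    ∃ L : HK K Ω hb →L[ℝ] Lp ℝ 2 (volume : Measure (Euc N)), IsCompactOperator L ∧
      ∀ u, ‖(HK.toLp K Ω hb - L) u‖ ^ 2 ≤ C * (n : ℝ) ^ (-(2 * s)) * ‖u‖ ^ 2 := by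
  obtain ⟨α, s, hα, hs, hK⟩ := exists_kernel_lower_bound K
  have hN : (0 : ℝ) < N := by exact_mod_cast K.dim_pos
  set C := (2 * (α * (Real.sqrt N) ^ (-((N : ℝ) + 2 * s))))⁻¹ with hC
  refine ⟨C, s, by positivity, hs, fun n hn => ?_⟩
  have hn' : (0 : ℝ) < n := by exact_mod_cast hn
  obtain ⟨S, hS⟩ := exists_cover_cube hb n
  have hf : ∀ ν : Fin N → ℤ, volume (cube n ν : Set (Euc N)) ≠ ⊤ := fun ν => by
    rw [volume_cube hn]; exact ENNReal.ofReal_ne_top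
  set v := ((n : ℝ)⁻¹) ^ N with hv
  have hv0 : 0 < v := by positivity
  set L := averaging S (measurableSet_cube n) hf v with hL
  refine ⟨L.comp (HK.toLp K Ω hb), (isCompactOperator_averaging S _ hf v).comp_clm _, fun u => ?_⟩
  have h1 := norm_sub_averaging_sq S (measurableSet_cube n) hf (pairwise_disjoint_cube n) hv0
    (fun ν => by rw [measureReal_def, volume_cube hn, ENNReal.toReal_ofReal hv0.le])
    (HK.toLp K Ω hb u) (by
      filter_upwards [(HK.toLp_mem K Ω hb u).2] with x hx h
      exact hx fun hΩ => h (hS hΩ))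
  rw [sub_apply, ContinuousLinearMap.comp_apply, h1]
  set c := α * (Real.sqrt N * (n : ℝ)⁻¹) ^ (-((N : ℝ) + 2 * s)) with hc
  have hc0 : 0 < c := by positivity
  have h2 := sum_setIntegral_le K Ω (u : XK K Ω) S hn (c := c) (fun x h0 hx => hK _ x h0 hx)
  rw [HK.norm_sq]
  -- The factor n^N from the cubes' volume is beaten by n^{-(N+2s)} from the kernel bound, leaving
  -- n^{-2s}.
  have h3 : C * (n : ℝ) ^ (-(2 * s)) = (2 * v)⁻¹ * c⁻¹ := by
    rw [hC, hc, hv, Real.mul_rpow (by positivity) (by positivity), Real.inv_rpow hn'.le,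
      Real.rpow_neg hn'.le ((N : ℝ) + 2 * s), inv_inv, Real.rpow_add hn', Real.rpow_natCast,
      Real.rpow_neg hn'.le (2 * s), inv_pow]
    field_simp
  rw [h3, mul_assoc]
  refine mul_le_mul_of_nonneg_left ?_ (by positivity)
  rw [inv_mul_eq_div, le_div_iff₀ hc0, mul_comm]
  exact h2

/-- The compact embedding of `X_K(Ω)` in `L²`. -/
theorem HK.isCompactOperator_toLp : IsCompactOperator (HK.toLp K Ω hb) := by
  obtain ⟨C, s, hC, hs, h⟩ := HK.exists_compact_approx K Ω hb
  choose L hLc hL using fun n : ℕ => h (n + 1) n.succ_pos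
  refine isCompactOperator_of_tendsto (F := L) (l := atTop) ?_ (Eventually.of_forall hLc)
  have hlim : Tendsto (fun n : ℕ => Real.sqrt (C * ((n + 1 : ℕ) : ℝ) ^ (-(2 * s)))) atTop (𝓝 0) := by
    have h1 : Tendsto (fun n : ℕ => ((n + 1 : ℕ) : ℝ) ^ (-(2 * s))) atTop (𝓝 0) :=
      (tendsto_rpow_neg_atTop (by positivity)).comp
        (tendsto_natCast_atTop_atTop.comp (tendsto_add_atTop_nat 1))
    have h2 := (h1.const_mul C).sqrt
    simpa using h2
  rw [tendsto_iff_norm_sub_tendsto_zero]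
  refine squeeze_zero (fun n => norm_nonneg _) (fun n => ?_) hlim
  refine ContinuousLinearMap.opNorm_le_bound _ (Real.sqrt_nonneg _) fun u => ?_
  rw [← norm_neg, ← neg_apply, neg_sub]
  refine abs_le_of_sq_le_sq' ?_ (by positivity) |>.2
  rw [mul_pow, Real.sq_sqrt (by positivity)]
  exact hL n u

end NonlocalEig

namespace NonlocalEig

variable {N : ℕ} (K : AdmissibleKernel N) (Ω : Set (Euc N)) (hb : Bornology.IsBounded Ω)

/-! ### Density of X_K(Ω) among the L² functions that vanish off Ω. -/

section Density

/-- A test function is Lipschitz and bounded, so (g(x) - g(y))² ≤ M min(|x - y|², 1), and the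
difference vanishes unless x or y lies in the support S. Tonelli bounds the energy by 2M|S| times
the integral of min(|z|², 1)K(z). -/
theorem energy_lt_top_of_contDiff {g : Euc N → ℝ} (hg : ContDiff ℝ (⊤ : ℕ∞) g)
    (hc : HasCompactSupport g) : energy K g < ⊤ := by
  obtain ⟨L, hL⟩ := hg.lipschitzWith_of_hasCompactSupport hc (by simp)
  obtain ⟨B, hB⟩ := hc.exists_bound_of_continuous hg.continuous
  set S := tsupport g with hS
  have hSm : MeasurableSet S := (isClosed_tsupport g).measurableSet
  have hSv : volume S < ⊤ := hc.measure_lt_top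
  set M : ℝ := (L : ℝ) ^ 2 + (2 * B) ^ 2 with hM
  have hM0 : 0 ≤ M := by positivity
  let k : Euc N → ℝ≥0∞ := fun z => ENNReal.ofReal (min (‖z‖ ^ 2) 1 * K.toFun z)
  have hk : ∫⁻ z, k z < ⊤ := K.integrable_min_mul.lintegral_lt_top
  have hkm : AEMeasurable k volume :=
    K.integrable_min_mul.aestronglyMeasurable.aemeasurable.ennreal_ofReal
  have hkm2 : AEMeasurable (fun p : Euc N × Euc N => k (p.1 - p.2)) (volume.prod volume) :=
    hkm.comp_quasiMeasurePreserving
      (quasiMeasurePreserving_sub_of_right_invariant volume volume)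
  let χ : Euc N → ℝ≥0∞ := S.indicator 1
  have hχm : Measurable χ := measurable_one.indicator hSm
  have hχ : ∫⁻ x, χ x < ⊤ := by simpa [χ, lintegral_indicator_one hSm] using hSv
  have hbound : energy K g ≤ ∫⁻ p : Euc N × Euc N, (ENNReal.ofReal M * (χ p.1 * k (p.1 - p.2)) +
      ENNReal.ofReal M * (χ p.2 * k (p.1 - p.2))) ∂(volume.prod volume) := by
    refine lintegral_mono_ae ?_
    filter_upwards [ae_sub_ne_zero K] with p hp
    have hK := K.nonneg hp
    have hmain : ENNReal.ofReal ((g p.1 - g p.2) ^ 2 * K.toFun (p.1 - p.2))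
        ≤ ENNReal.ofReal M * k (p.1 - p.2) := by
      rw [← ENNReal.ofReal_mul hM0, ← mul_assoc]
      refine ENNReal.ofReal_le_ofReal (mul_le_mul_of_nonneg_right ?_ hK)
      have h1 : (g p.1 - g p.2) ^ 2 ≤ (L : ℝ) ^ 2 * ‖p.1 - p.2‖ ^ 2 := by
        rw [← mul_pow, ← sq_abs, ← Real.norm_eq_abs]
        gcongr
        exact hL.norm_sub_le _ _
      have h2 : (g p.1 - g p.2) ^ 2 ≤ (2 * B) ^ 2 := by
        rw [← sq_abs, ← Real.norm_eq_abs]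
        gcongr
        exact (norm_sub_le _ _).trans (by linarith [hB p.1, hB p.2])
      rcases min_cases (‖p.1 - p.2‖ ^ 2) 1 with ⟨h, _⟩ | ⟨h, _⟩ <;> rw [h]
      · exact h1.trans (by gcongr; nlinarith [sq_nonneg (2 * B)])
      · nlinarith [sq_nonneg (L : ℝ)]
    by_cases h1 : p.1 ∈ S
    · refine hmain.trans (le_trans ?_ le_self_add)
      simp [χ, h1]
    by_cases h2 : p.2 ∈ S
    · refine hmain.trans (le_trans ?_ le_add_self)
      simp [χ, h2]
    · simp [image_eq_zero_of_notMem_tsupport h1, image_eq_zero_of_notMem_tsupport h2]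
  refine hbound.trans_lt ?_
  have hm1 : AEMeasurable (fun p : Euc N × Euc N => χ p.1 * k (p.1 - p.2)) (volume.prod volume) :=
    (hχm.comp measurable_fst).aemeasurable.mul hkm2
  have hm2 : AEMeasurable (fun p : Euc N × Euc N => χ p.2 * k (p.1 - p.2)) (volume.prod volume) :=
    (hχm.comp measurable_snd).aemeasurable.mul hkm2
  rw [lintegral_add_left' (hm1.const_mul _), lintegral_const_mul' _ _ ENNReal.ofReal_ne_top,
    lintegral_const_mul' _ _ ENNReal.ofReal_ne_top, lintegral_prod _ hm1, lintegral_prod_symm _ hm2]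
  have e1 : ∀ x, ∫⁻ y, χ x * k (x - y) = χ x * ∫⁻ z, k z := fun x => by
    rw [lintegral_const_mul' _ _ (by by_cases h : x ∈ S <;> simp [χ, h]),
      lintegral_sub_left_eq_self k x]
  have e2 : ∀ y, ∫⁻ x, χ y * k (x - y) = χ y * ∫⁻ z, k z := fun y => by
    rw [lintegral_const_mul' _ _ (by by_cases h : y ∈ S <;> simp [χ, h]),
      lintegral_sub_right_eq_self k y]
  simp only [e1, e2]
  rw [lintegral_mul_const' _ _ hk.ne]
  have := ENNReal.mul_lt_top hχ hk
  exact ENNReal.add_lt_top.mpr ⟨ENNReal.mul_lt_top ENNReal.ofReal_lt_top this,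
    ENNReal.mul_lt_top ENNReal.ofReal_lt_top this⟩

/-- The component z of f orthogonal to X_K(Ω) annihilates all test functions in Ω, hence vanishes
there, while f vanishes elsewhere. So z is orthogonal to f, and therefore zero. -/
theorem mem_closure_XK {Ω : Set (Euc N)} (hΩo : IsOpen Ω)
    {f : Lp ℝ 2 (volume : Measure (Euc N))} (hf : ∀ᵐ x, x ∉ Ω → f x = 0) :
    f ∈ (XK K Ω).topologicalClosure := by
  obtain ⟨y, hy, z, hz, rfl⟩ := Submodule.exists_add_mem_mem_orthogonal
    (K := (XK K Ω).topologicalClosure) f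
  have hz0 : ∀ᵐ x, x ∈ Ω → z x = 0 := by
    refine hΩo.ae_eq_zero_of_integral_contDiff_smul_eq_zero
      (((Lp.memLp z).locallyIntegrable (by norm_num)).locallyIntegrableOn Ω) fun g hg hc hs => ?_
    have hgL : MemLp g 2 (volume : Measure (Euc N)) := hg.continuous.memLp_of_hasCompactSupport hc
    have hge := hgL.coeFn_toLp
    have hgX : hgL.toLp g ∈ XK K Ω := by
      refine ⟨?_, ?_⟩
      · rw [energy_congr K hge]
        exact energy_lt_top_of_contDiff K hg hc
      · filter_upwards [hge] with x hx h
        rw [hx]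
        exact image_eq_zero_of_notMem_tsupport fun h' => h (hs h')
    have h0 := (Submodule.mem_orthogonal _ _).mp hz _ (Submodule.le_topologicalClosure _ hgX)
    rw [L2.inner_def] at h0
    rw [← h0]
    refine integral_congr_ae ?_
    filter_upwards [hge] with x hx
    simp [hx, mul_comm]
  have h1 : inner ℝ z (y + z) = 0 := by
    rw [L2.inner_def]
    refine integral_eq_zero_of_ae ?_
    filter_upwards [hf, hz0] with x hx hx'
    by_cases h : x ∈ Ω
    · simp [hx' h]
    · simp only [hx h, inner_zero_right, Pi.zero_apply]
  rw [inner_add_right, (Submodule.mem_orthogonal' _ _).mp hz _ hy, zero_add,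
    inner_self_eq_zero] at h1
  rw [h1, add_zero]
  exact hy

end Density

/-! ### The operator of the weighted form and its positive subspaces. -/

section Weight

/-- Multiplication by a bounded function on `L²`. -/
noncomputable def mulOp (r : Lp ℝ ∞ (volume : Measure (Euc N))) :
    Lp ℝ 2 (volume : Measure (Euc N)) →L[ℝ] Lp ℝ 2 (volume : Measure (Euc N)) :=
  (ContinuousLinearMap.mul ℝ ℝ).holderL volume ∞ 2 2 r

theorem coeFn_mulOp (r : Lp ℝ ∞ (volume : Measure (Euc N)))
    (f : Lp ℝ 2 (volume : Measure (Euc N))) : mulOp r f =ᵐ[volume] fun x => r x * f x :=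
  (ContinuousLinearMap.mul ℝ ℝ).coeFn_holder r f

theorem inner_mulOp (r : Lp ℝ ∞ (volume : Measure (Euc N)))
    (f g : Lp ℝ 2 (volume : Measure (Euc N))) :
    inner ℝ (mulOp r f) g = ∫ x, r x * f x * g x := by
  rw [L2.inner_def]
  refine integral_congr_ae ?_
  filter_upwards [coeFn_mulOp r f] with x hx
  simp [hx, mul_comm]

/-- The compact operator representing `∫ r u v` on `X_K(Ω)`. -/
noncomputable def weightOp (r : Lp ℝ ∞ (volume : Measure (Euc N))) :
    HK K Ω hb →L[ℝ] HK K Ω hb :=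
  (ContinuousLinearMap.adjoint (HK.toLp K Ω hb)).comp ((mulOp r).comp (HK.toLp K Ω hb))

variable (r : Lp ℝ ∞ (volume : Measure (Euc N)))

theorem inner_weightOp (u v : HK K Ω hb) : inner ℝ (weightOp K Ω hb r u) v
    = inner ℝ (mulOp r (HK.toLp K Ω hb u)) (HK.toLp K Ω hb v) := by
  rw [weightOp, ContinuousLinearMap.comp_apply, ContinuousLinearMap.adjoint_inner_left,
    ContinuousLinearMap.comp_apply]

theorem isCompactOperator_weightOp : IsCompactOperator (weightOp K Ω hb r) :=
  ((HK.isCompactOperator_toLp K Ω hb).clm_comp (mulOp r)).clm_comp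
    (ContinuousLinearMap.adjoint (HK.toLp K Ω hb))

theorem weightOp_symm (u v : HK K Ω hb) :
    inner ℝ (weightOp K Ω hb r u) v = inner ℝ u (weightOp K Ω hb r v) := by
  rw [real_inner_comm _ u, inner_weightOp, inner_weightOp, inner_mulOp, inner_mulOp]
  congr 1; ext x; ring

variable {r} {ρ : Euc N → ℝ}

/-- Elements of X_K(Ω) vanish off Ω, so the values of r there do not matter. -/
theorem inner_weightOp_eq (hr : r =ᵐ[volume.restrict Ω] ρ)
    (u v : HK K Ω hb) : inner ℝ (weightOp K Ω hb r u) v = weightForm K Ω ρ u v := by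
  change _ = ∫ x in Ω, ρ x * HK.toLp K Ω hb u x * HK.toLp K Ω hb v x
  rw [inner_weightOp, inner_mulOp, ← setIntegral_eq_integral_of_ae_compl_eq_zero
    (s := Ω)]
  · refine integral_congr_ae ?_
    filter_upwards [hr] with x hx
    rw [hx]
  · filter_upwards [(HK.toLp_mem K Ω hb u).2] with x hx h
    simp [hx h]

theorem weightQuad_eq (u : XK K Ω) : weightQuad K Ω ρ u = weightForm K Ω ρ u u := by
  unfold weightQuad weightForm
  congr 1; ext x; ring

/-- Lebesgue measure restricted to A has no atoms, so its support is infinite. Disjoint open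
neighbourhoods of k support points each meet A in positive measure. -/
theorem exists_disjoint_subsets {A : Set (Euc N)} (hAm : MeasurableSet A) (hA : volume A ≠ 0)
    (hN : 0 < N) (k : ℕ) : ∃ B : Fin k → Set (Euc N), (∀ i, MeasurableSet (B i)) ∧
      (∀ i, B i ⊆ A) ∧ (∀ i, volume (B i) ≠ 0) ∧ ∀ i j, i ≠ j → Disjoint (B i) (B j) := by
  have : Nonempty (Fin N) := ⟨⟨0, hN⟩⟩
  set m := (volume : Measure (Euc N)).restrict A with hm
  have hinf : m.support.Infinite := by
    intro hfin
    have h1 : m m.support = 0 := hfin.measure_zero m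
    have h2 : m m.supportᶜ = 0 := Measure.measure_compl_support
    have h3 : m Set.univ = 0 := by
      rw [← Set.union_compl_self m.support]
      exact measure_union_null h1 h2
    exact hA (by simpa [hm] using h3)
  obtain ⟨t, ht, hcard⟩ := hinf.exists_subset_card_eq k
  obtain ⟨U, hU, hd⟩ := t.finite_toSet.t2_separation
  let φ := (t.equivFinOfCardEq hcard).symm
  refine ⟨fun i => U (φ i) ∩ A, fun i => (hU _).2.measurableSet.inter hAm,
    fun i => Set.inter_subset_right, fun i => ?_, fun i j hij => ?_⟩
  · have h1 := (Measure.mem_support_iff_forall (φ i : Euc N)).mp (ht (φ i).2) (U (φ i))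
      ((hU _).2.mem_nhds (hU _).1)
    rw [hm, Measure.restrict_apply (hU _).2.measurableSet] at h1
    exact h1.ne'
  · have hne : (φ i : Euc N) ≠ φ j := fun h => hij (φ.injective (Subtype.ext h))
    exact (hd (φ i).2 (φ j).2 hne).mono Set.inter_subset_left Set.inter_subset_left

/-- On indicators of disjoint subsets B_i of {r > 0} the form is diagonal with entries ∫_{B_i} r >
0. These indicators need not have finite energy, so they are only taken in L². -/
theorem exists_posDef_family (hr : r =ᵐ[volume.restrict Ω] ρ) (hΩm : MeasurableSet Ω)
    (hN : 0 < N) (hb : Bornology.IsBounded Ω)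
    (hρ : ¬ ρ⁺ =ᵐ[volume.restrict Ω] 0) (k : ℕ) :
    ∃ f : Fin k → Lp ℝ 2 (volume : Measure (Euc N)), (∀ i, ∀ᵐ x, x ∉ Ω → f i x = 0) ∧
      ∀ c : Fin k → ℝ, c ≠ 0 → 0 < inner ℝ (mulOp r (∑ i, c i • f i)) (∑ i, c i • f i) := by
  classical
  set A := Ω ∩ {x | 0 < r x} with hA
  have hrm : Measurable r := (Lp.stronglyMeasurable r).measurable
  have hAm : MeasurableSet A := hΩm.inter (measurableSet_lt measurable_const hrm)
  have hA0 : volume A ≠ 0 := by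
    intro h0
    refine hρ ?_
    have h1 : ∀ᵐ x ∂volume.restrict Ω, ¬ 0 < r x := by
      rw [ae_restrict_iff' hΩm, ae_iff]
      convert h0 using 2
      ext x; simp [hA]
    filter_upwards [hr, h1] with x hx hx'
    rw [hx, not_lt] at hx'
    simpa [Pi.posPart_apply] using hx'
  have hAf : volume A ≠ ⊤ :=
    ((hb.subset Set.inter_subset_left).measure_lt_top).ne
  obtain ⟨B, hBm, hBA, hB0, hBd⟩ := exists_disjoint_subsets hAm hA0 hN k
  have hBf : ∀ i, volume (B i) ≠ ⊤ := fun i => ne_top_of_le_ne_top hAf (measure_mono (hBA i))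
  set f : Fin k → Lp ℝ 2 (volume : Measure (Euc N)) := fun i =>
    indicatorConstLp 2 (hBm i) (hBf i) (1 : ℝ) with hf
  have hfe : ∀ i, f i =ᵐ[volume] (B i).indicator fun _ => (1 : ℝ) := fun i =>
    indicatorConstLp_coeFn
  refine ⟨f, fun i => ?_, fun c hc => ?_⟩
  · filter_upwards [hfe i] with x hx h
    rw [hx, Set.indicator_of_notMem]
    exact fun h' => h (hBA i h').1
  have hform : ∀ i j, inner ℝ (mulOp r (f i)) (f j) = if i = j then ∫ x in B i, r x else 0 := by
    intro i j
    rw [real_inner_comm, hf, L2.inner_indicatorConstLp_one]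
    have h1 : ∫ x in B j, mulOp r (f i) x = ∫ x in B j, r x * (B i).indicator (fun _ => (1 : ℝ)) x := by
      refine integral_congr_ae (ae_restrict_of_ae ?_)
      filter_upwards [coeFn_mulOp r (f i), hfe i] with x hx hx'
      rw [hx, hx']
    rw [h1]
    split_ifs with h
    · subst h
      refine setIntegral_congr_fun (hBm i) fun x hx => ?_
      simp [hx]
    · refine integral_eq_zero_of_ae ?_
      filter_upwards [ae_restrict_mem (hBm j)] with x hx
      have : x ∉ B i := fun hx' => Set.disjoint_left.mp (hBd i j h) hx' hx
      simp [this]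
  have hpos : ∀ i, 0 < ∫ x in B i, r x := by
    intro i
    have hi : IntegrableOn r (B i) volume := by
      have : IsFiniteMeasure (volume.restrict (B i)) := ⟨by simpa using (hBf i).lt_top⟩
      exact ((Lp.memLp r).restrict (B i)).integrable le_top
    rw [setIntegral_pos_iff_support_of_nonneg_ae _ hi]
    · refine lt_of_lt_of_le (pos_iff_ne_zero.mpr (hB0 i)) (measure_mono fun x hx => ?_)
      exact ⟨ne_of_gt (hBA i hx).2, hx⟩
    · filter_upwards [ae_restrict_mem (hBm i)] with x hx
      exact (hBA i hx).2.le
  have hq : inner ℝ (mulOp r (∑ i, c i • f i)) (∑ i, c i • f i) = ∑ i, c i ^ 2 * ∫ x in B i, r x := by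
    rw [map_sum, sum_inner]
    refine Finset.sum_congr rfl fun i _ => ?_
    rw [inner_sum]
    simp only [map_smul, inner_smul_left, inner_smul_right, hform, conj_trivial, mul_ite, mul_zero]
    rw [Finset.sum_ite_eq Finset.univ i, if_pos (Finset.mem_univ i)]
    ring
  rw [hq]
  obtain ⟨i, hi⟩ := Function.ne_iff.mp hc
  refine Finset.sum_pos' (fun j _ => mul_nonneg (sq_nonneg _) (hpos j).le)
    ⟨i, Finset.mem_univ i, mul_pos (sq_pos_of_ne_zero hi) (hpos i)⟩

/-- The indicators lie in the L² closure of X_K(Ω), so nearby elements of X_K(Ω) keep the form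
positive; positivity at every nonzero coefficient vector also forces linear independence. -/
theorem exists_positive_subspace (hr : r =ᵐ[volume.restrict Ω] ρ) (hΩo : IsOpen Ω)
    (hρ : ¬ ρ⁺ =ᵐ[volume.restrict Ω] 0) (k : ℕ) :
    ∃ F : Submodule ℝ (HK K Ω hb), FiniteDimensional ℝ F ∧ Module.finrank ℝ F = k ∧
      ∀ u ∈ F, u ≠ 0 → 0 < inner ℝ (weightOp K Ω hb r u) u := by
  obtain ⟨f, hf0, hfp⟩ := exists_posDef_family Ω hr hΩo.measurableSet K.dim_pos hb hρ k
  set M := (XK K Ω).topologicalClosure with hM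
  have hD : Dense {m : M | (m : Lp ℝ 2 (volume : Measure (Euc N))) ∈ XK K Ω} := by
    rw [Topology.IsInducing.subtypeVal.dense_iff]
    intro m
    have : (Subtype.val '' {m : M | (m : Lp ℝ 2 (volume : Measure (Euc N))) ∈ XK K Ω})
        = (XK K Ω : Set (Lp ℝ 2 (volume : Measure (Euc N)))) := by
      ext x
      constructor
      · rintro ⟨y, hy, rfl⟩; exact hy
      · exact fun hx => ⟨⟨x, Submodule.le_topologicalClosure _ hx⟩, hx, rfl⟩
    exact (congrArg closure this).symm ▸ m.2
  obtain ⟨g, hgD, hgp⟩ := CompactSymmetric.exists_positive_of_dense hD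
    (q := fun m : M => inner ℝ (mulOp r (m : Lp ℝ 2 (volume : Measure (Euc N))))
      (m : Lp ℝ 2 (volume : Measure (Euc N)))) (by fun_prop)
    (fun c u => by
      simp only [Submodule.coe_smul, map_smul, inner_smul_left, inner_smul_right, conj_trivial]
      ring)
    (fun i => (⟨f i, mem_closure_XK K hΩo (hf0 i)⟩ : M)) (fun c hc => by simpa using hfp c hc)
  let G : Fin k → HK K Ω hb := fun i => (⟨(g i : Lp ℝ 2 (volume : Measure (Euc N))), hgD i⟩ : XK K Ω)
  have hGt : ∀ i, HK.toLp K Ω hb (G i) = g i := fun i => rfl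
  have hGp : ∀ c : Fin k → ℝ, c ≠ 0 →
      0 < inner ℝ (weightOp K Ω hb r (∑ i, c i • G i)) (∑ i, c i • G i) := by
    intro c hc
    rw [inner_weightOp]
    simp only [map_sum, map_smul, hGt]
    simpa using hgp c hc
  have hli : LinearIndependent ℝ G := by
    rw [Fintype.linearIndependent_iff]
    intro c hc
    by_contra hne
    have := hGp c fun h => hne fun i => by rw [h]; rfl
    rw [hc] at this
    simp at this
  refine ⟨Submodule.span ℝ (Set.range G), FiniteDimensional.span_of_finite ℝ (Set.finite_range G),
    by simpa using finrank_span_eq_card hli, fun u hu h0 => ?_⟩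
  obtain ⟨c, rfl⟩ := (Submodule.mem_span_range_iff_exists_fun ℝ).mp hu
  refine hGp c ?_
  rintro rfl
  simp at h0

end Weight

end NonlocalEig

namespace NonlocalEig

variable {N : ℕ} (K : AdmissibleKernel N) (Ω : Set (Euc N)) (hb : Bornology.IsBounded Ω)

/-! ### Simplicity of the first positive eigenvalue. -/

section Simplicity

theorem AdmissibleKernel.pos (K : AdmissibleKernel N) {x : Euc N} (hx : x ≠ 0) :
    0 < K.toFun x := by
  obtain ⟨α, s, hα, _, h⟩ := exists_kernel_lower_bound K
  have : 0 < ‖x‖ := norm_pos_iff.mpr hx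
  exact lt_of_lt_of_le (by positivity) (h ‖x‖ x hx le_rfl)

theorem abs_sub_abs_sq_le (a b : ℝ) : (|a| - |b|) ^ 2 ≤ (a - b) ^ 2 :=
  sq_le_sq.mpr (abs_abs_sub_abs_le_abs_sub a b)

/-- The equality case of the preceding inequality: expanding the squares leaves |ab| ≤ ab. -/
theorem mul_nonneg_of_abs_sub_abs_sq {a b : ℝ} (h : (a - b) ^ 2 ≤ (|a| - |b|) ^ 2) :
    0 ≤ a * b := by
  have h1 := sq_abs a
  have h2 := sq_abs b
  have h3 := abs_nonneg (a * b)
  rw [abs_mul] at h3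
  nlinarith

theorem exists_abs (u : HK K Ω hb) : ∃ w : HK K Ω hb,
    HK.toLp K Ω hb w =ᵐ[volume] fun x => |HK.toLp K Ω hb u x| := by
  set f := HK.toLp K Ω hb u with hf
  have hfm := (Lp.aestronglyMeasurable f).aemeasurable
  have hmem : |f| ∈ XK K Ω := by
    refine ⟨lt_of_le_of_lt ?_ (HK.toLp_mem K Ω hb u).1, ?_⟩
    · rw [energy_congr K (Lp.coeFn_abs f)]
      refine lintegral_mono_ae ?_
      filter_upwards [ae_sub_ne_zero K] with p hp
      exact ENNReal.ofReal_le_ofReal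
        (mul_le_mul_of_nonneg_right (abs_sub_abs_sq_le _ _) (K.nonneg hp))
    · filter_upwards [Lp.coeFn_abs f, (HK.toLp_mem K Ω hb u).2] with x hx h hΩ
      rw [hx, h hΩ, abs_zero]
  exact ⟨(⟨|f|, hmem⟩ : XK K Ω), Lp.coeFn_abs f⟩

variable {r : Lp ℝ ∞ (volume : Measure (Euc N))} {μ : ℝ}

/-- A maximizer of the Rayleigh quotient has constant sign. -/
theorem constant_sign_of_isMax (hμ : 0 < μ)
    (hmax : ∀ v : HK K Ω hb, inner ℝ (weightOp K Ω hb r v) v ≤ μ * ‖v‖ ^ 2)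
    {u : HK K Ω hb} (hu : inner ℝ (weightOp K Ω hb r u) u = μ * ‖u‖ ^ 2) :
    (∀ᵐ x, 0 ≤ HK.toLp K Ω hb u x) ∨ ∀ᵐ x, HK.toLp K Ω hb u x ≤ 0 := by
  obtain ⟨w, hw⟩ := exists_abs K Ω hb u
  have hq : inner ℝ (weightOp K Ω hb r w) w = inner ℝ (weightOp K Ω hb r u) u := by
    rw [inner_weightOp, inner_weightOp, inner_mulOp, inner_mulOp]
    refine integral_congr_ae ?_
    filter_upwards [hw] with x hx
    rw [hx, mul_assoc, mul_assoc, abs_mul_abs_self]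
  have hle : ‖u‖ ^ 2 ≤ ‖w‖ ^ 2 := by
    have := hmax w
    rw [hq, hu] at this
    exact le_of_mul_le_mul_left this hμ
  let f : Euc N → ℝ := HK.toLp K Ω hb u
  let g : Euc N → ℝ := HK.toLp K Ω hb w
  have hgf : g =ᵐ[volume] fun x => |f x| := hw
  have hI : ∀ v : HK K Ω hb, Integrable (fun p : Euc N × Euc N =>
      (HK.toLp K Ω hb v p.1 - HK.toLp K Ω hb v p.2) ^ 2 * K.toFun (p.1 - p.2))
      (volume.prod volume) := fun v =>
    integrable_energy K (Lp.aestronglyMeasurable _).aemeasurable (HK.toLp_mem K Ω hb v).1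
  have hn : ∀ v : HK K Ω hb, ‖v‖ ^ 2 = ∫ p : Euc N × Euc N,
      (HK.toLp K Ω hb v p.1 - HK.toLp K Ω hb v p.2) ^ 2 * K.toFun (p.1 - p.2)
      ∂(volume.prod volume) := fun v => by
    rw [HK.norm_sq]
    change kInner K (HK.toLp K Ω hb v) (HK.toLp K Ω hb v) = _
    simp only [kInner, sq]
  have hpt : ∀ᵐ p : Euc N × Euc N ∂(volume.prod volume),
      (g p.1 - g p.2) ^ 2 * K.toFun (p.1 - p.2) ≤ (f p.1 - f p.2) ^ 2 * K.toFun (p.1 - p.2) := by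
    filter_upwards [ae_sub_ne_zero K, ae_prod_of_ae hgf] with p hp h
    rw [h.1, h.2]
    exact mul_le_mul_of_nonneg_right (abs_sub_abs_sq_le _ _) (K.nonneg hp)
  -- Maximality gives ‖u‖ ≤ ‖|u|‖, while the integrands compare pointwise the other way; hence they
  -- agree a.e.
  have hzero : (fun p : Euc N × Euc N => (f p.1 - f p.2) ^ 2 * K.toFun (p.1 - p.2)
      - (g p.1 - g p.2) ^ 2 * K.toFun (p.1 - p.2)) =ᵐ[volume.prod volume] 0 := by
    have hnn : 0 ≤ᵐ[volume.prod volume] (fun p : Euc N × Euc N =>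
        (f p.1 - f p.2) ^ 2 * K.toFun (p.1 - p.2)
        - (g p.1 - g p.2) ^ 2 * K.toFun (p.1 - p.2)) := by
      filter_upwards [hpt] with p hp
      exact sub_nonneg.mpr hp
    rw [← integral_eq_zero_iff_of_nonneg_ae hnn ((hI u).sub (hI w))]
    refine le_antisymm ?_ (integral_nonneg_of_ae hnn)
    rw [integral_sub (hI u) (hI w), ← hn, ← hn]
    linarith
  have hprod : ∀ᵐ p : Euc N × Euc N ∂(volume.prod volume), 0 ≤ f p.1 * f p.2 := by
    filter_upwards [ae_sub_ne_zero K, hzero, ae_prod_of_ae hgf] with p hp h0 h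
    have h0' : (f p.1 - f p.2) ^ 2 * K.toFun (p.1 - p.2)
      - (g p.1 - g p.2) ^ 2 * K.toFun (p.1 - p.2) = 0 := h0
    rw [h.1, h.2, ← sub_mul, mul_eq_zero] at h0'
    rcases h0' with h0' | h0'
    · exact mul_nonneg_of_abs_sub_abs_sq (sub_eq_zero.mp h0').le
    · exact absurd h0' (K.pos hp).ne'
  -- Positivity of K has given u(x)u(y) ≥ 0 for almost all pairs. Fixing one good x with u(x) > 0,
  -- if such x have positive measure, settles the sign of u a.e.
  have h2 := Measure.ae_ae_of_ae_prod hprod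
  by_cases hneg : ∀ᵐ x, f x ≤ 0
  · exact Or.inr hneg
  · left
    obtain ⟨x, hx, hx'⟩ := ((not_eventually.mp hneg).and_eventually h2).exists
    filter_upwards [hx'] with y hy
    exact nonneg_of_mul_nonneg_right hy (not_le.mp hx)

theorem eq_zero_of_constant_sign (hΩm : MeasurableSet Ω) {u : HK K Ω hb}
    (hs : (∀ᵐ x, 0 ≤ HK.toLp K Ω hb u x) ∨ ∀ᵐ x, HK.toLp K Ω hb u x ≤ 0)
    (h0 : ∫ x in Ω, HK.toLp K Ω hb u x = 0) : u = 0 := by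
  have key : ∀ v : HK K Ω hb, (∀ᵐ x, 0 ≤ HK.toLp K Ω hb v x) →
      ∫ x in Ω, HK.toLp K Ω hb v x = 0 → v = 0 := by
    intro v hv hv0
    have : IsFiniteMeasure (volume.restrict Ω) := ⟨by simpa using hb.measure_lt_top⟩
    have hi : IntegrableOn (HK.toLp K Ω hb v) Ω volume :=
      ((Lp.memLp _).restrict Ω).integrable (by norm_num)
    rw [setIntegral_eq_zero_iff_of_nonneg_ae (ae_restrict_of_ae hv) hi,
      EventuallyEq, ae_restrict_iff' hΩm] at hv0
    have h1 : HK.toLp K Ω hb v = 0 := by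
      rw [Lp.eq_zero_iff_ae_eq_zero]
      filter_upwards [hv0, (HK.toLp_mem K Ω hb v).2] with x hx hx'
      by_cases h : x ∈ Ω
      · exact hx h
      · exact hx' h
    exact (Subtype.ext h1 : (v : XK K Ω) = 0)
  rcases hs with hs | hs
  · exact key u hs h0
  · rw [← neg_eq_zero]
    have hn : HK.toLp K Ω hb (-u) =ᵐ[volume] fun x => -HK.toLp K Ω hb u x := by
      rw [map_neg]; exact Lp.coeFn_neg _
    refine key (-u) ?_ ?_
    · filter_upwards [hs, hn] with x hx hx'
      rw [hx']; linarith
    · rw [integral_congr_ae (ae_restrict_of_ae hn), integral_neg, h0, neg_zero]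

/-- The largest eigenvalue of `weightOp` is simple. -/
theorem isPosEigenSeq_one_lt_zero (hΩm : MeasurableSet Ω) {e : ℕ → HK K Ω hb} {μ : ℕ → ℝ}
    (h : CompactSymmetric.IsPosEigenSeq (weightOp K Ω hb r) e μ) : μ 1 < μ 0 := by
  refine lt_of_le_of_ne (h.antitone (Nat.zero_le 1)) fun heq => ?_
  have hΩf : volume Ω ≠ ⊤ := hb.measure_lt_top.ne
  set l : HK K Ω hb → ℝ := fun u =>
    inner ℝ (indicatorConstLp 2 hΩm hΩf (1 : ℝ)) (HK.toLp K Ω hb u) with hl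
  have hmax : ∀ v : HK K Ω hb, inner ℝ (weightOp K Ω hb r v) v ≤ μ 0 * ‖v‖ ^ 2 :=
    fun v => h.le 0 v (by simp)
  -- If μ 1 = μ 0, every combination of e 0 and e 1 is a maximizer and so has constant sign; `l` is
  -- its integral over Ω, so it vanishes as soon as `l` does.
  have hzero : ∀ a b : ℝ, l (a • e 0 + b • e 1) = 0 → a • e 0 + b • e 1 = 0 := by
    intro a b hab
    rw [hl] at hab
    simp only at hab
    rw [L2.inner_indicatorConstLp_one] at hab
    refine eq_zero_of_constant_sign K Ω hb hΩm
      (constant_sign_of_isMax K Ω hb (h.pos 0) hmax ?_) hab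
    have : weightOp K Ω hb r (a • e 0 + b • e 1) = μ 0 • (a • e 0 + b • e 1) := by
      rw [map_add, map_smul, map_smul, h.eigen, h.eigen, heq, smul_add, smul_comm a, smul_comm b]
    rw [this, inner_smul_left, real_inner_self_eq_norm_sq]
    simp
  have h01 : inner ℝ (e 0) (e 1) = 0 := h.orthonormal.2 (by norm_num)
  have hl2 : ∀ a b : ℝ, l (a • e 0 + b • e 1) = a * l (e 0) + b * l (e 1) := by
    intro a b
    simp only [hl, map_add, map_smul, inner_add_right, inner_smul_right]
  have hcoef : ∀ a b : ℝ, a • e 0 + b • e 1 = 0 → a = 0 := by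
    intro a b hab
    have h1 : inner ℝ (e 0) (a • e 0 + b • e 1) = 0 := by rw [hab, inner_zero_right]
    rw [inner_add_right, inner_smul_right, inner_smul_right, h01, real_inner_self_eq_norm_sq,
      h.orthonormal.1] at h1
    simpa using h1
  -- The combination l(e 1) e 0 - l(e 0) e 1 has integral zero, hence is zero, so l(e 1) = 0; then e
  -- 1 itself must vanish.
  have h1 : l (e 1) = 0 := hcoef _ (-l (e 0)) (hzero _ _ (by rw [hl2]; ring))
  have h2 := hzero 0 1 (by rw [hl2, h1]; ring)
  have h3 : e 1 = 0 := by simpa using h2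
  have := h.orthonormal.1 1
  rw [h3, norm_zero] at this
  exact zero_ne_one this

end Simplicity

end NonlocalEig

namespace NonlocalEig

/-! ### Min-max formulas for the eigenvalues in X_K(Ω). -/

variable {N : ℕ} (K : AdmissibleKernel N) (Ω : Set (Euc N)) (ρ : Euc N → ℝ)

/-- A sequence of `ip`-orthonormal eigenfunctions exhausting the positive part of the weighted
form, with the reciprocals `μ` of their eigenvalues. -/
structure IsEigenSequence (e : ℕ → XK K Ω) (μ : ℕ → ℝ) : Prop where
  ip_eq : ∀ i j, ip K Ω (e i) (e j) = if i = j then 1 else 0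
  pos : ∀ n, 0 < μ n
  antitone : Antitone μ
  one_lt_zero : μ 1 < μ 0
  tendsto : Tendsto μ atTop (𝓝 0)
  form_eq : ∀ n v, weightForm K Ω ρ (e n) v = μ n * ip K Ω (e n) v
  quad_le : ∀ n u, (∀ v ∈ Submodule.span ℝ (e '' Set.Iio n), ip K Ω u v = 0) →
    weightQuad K Ω ρ u ≤ μ n * nrm K Ω u ^ 2
  le_quad : ∀ n, ∀ u ∈ Submodule.span ℝ (e '' Set.Iio (n + 1)),
    μ n * nrm K Ω u ^ 2 ≤ weightQuad K Ω ρ u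

variable {K Ω ρ}

theorem exists_weight (hΩm : MeasurableSet Ω) (hρ : MemLp ρ ∞ (volume.restrict Ω)) :
    ∃ r : Lp ℝ ∞ (volume : Measure (Euc N)), r =ᵐ[volume.restrict Ω] ρ := by
  have h := (memLp_indicator_iff_restrict hΩm).2 hρ
  refine ⟨h.toLp _, ?_⟩
  filter_upwards [ae_restrict_of_ae h.coeFn_toLp, ae_restrict_mem hΩm] with x hx hΩ
  rw [hx, Set.indicator_of_mem hΩ]

/-- Transfers the spectral result for `weightOp` to `ip`, `nrm` and the weighted integrals. Indices
start at 0, so μ n is the reciprocal of the eigenvalue number n + 1. -/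
theorem exists_isEigenSequence (hΩo : IsOpen Ω) (hb : Bornology.IsBounded Ω)
    (hρ : MemLp ρ ∞ (volume.restrict Ω)) (hpos : ¬ ρ⁺ =ᵐ[volume.restrict Ω] 0) :
    ∃ e μ, IsEigenSequence K Ω ρ e μ := by
  obtain ⟨r, hr⟩ := exists_weight hΩo.measurableSet hρ
  obtain ⟨e, μ, h⟩ := CompactSymmetric.exists_isPosEigenSeq (weightOp K Ω hb r)
    (isCompactOperator_weightOp K Ω hb r) (weightOp_symm K Ω hb r)
    (exists_positive_subspace K Ω hb hr hΩo hpos)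
  have hQ : ∀ u : HK K Ω hb, inner ℝ (weightOp K Ω hb r u) u = weightQuad K Ω ρ u := fun u => by
    rw [inner_weightOp_eq K Ω hb hr]; exact (weightQuad_eq K Ω u).symm
  refine ⟨e, μ, fun i j => ?_, h.pos, h.antitone,
    isPosEigenSeq_one_lt_zero K Ω hb hΩo.measurableSet h,
    h.tendsto (isCompactOperator_weightOp K Ω hb r), fun n v => ?_, fun n u hu => ?_,
    fun n u hu => ?_⟩
  · exact orthonormal_iff_ite.mp h.orthonormal i j
  · let v' : HK K Ω hb := v
    have h1 := inner_weightOp_eq K Ω hb hr (e n) v'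
    rw [h.eigen, inner_smul_left] at h1
    exact h1.symm
  · exact (hQ u).symm.le.trans (h.le n u ((Submodule.mem_orthogonal' _ _).mpr hu))
  · exact (h.ge_of_mem_span n u hu).trans (hQ u).le

theorem nrm_sq (u : XK K Ω) : nrm K Ω u ^ 2 = ip K Ω u u :=
  Real.sq_sqrt (kInner_self_nonneg K _)

theorem ip_comm (u v : XK K Ω) : ip K Ω u v = ip K Ω v u := kInner_comm K _ _

theorem ip_self_pos (hb : Bornology.IsBounded Ω) {u : XK K Ω} (hu : u ≠ 0) : 0 < ip K Ω u u := by
  have h : 0 < ‖(show HK K Ω hb from u)‖ ^ 2 := by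
    have : (show HK K Ω hb from u) ≠ 0 := hu
    positivity
  rwa [HK.norm_sq] at h

theorem exists_isMinOn_unitSphere (hΩo : IsOpen Ω) (hb : Bornology.IsBounded Ω)
    (hρ : MemLp ρ ∞ (volume.restrict Ω)) {k : ℕ} (hk : 1 ≤ k) {F : Submodule ℝ (XK K Ω)}
    (hF : F ∈ subspacesOfDim K Ω k) : ∃ u ∈ unitSphere K Ω F,
      IsMinOn (weightQuad K Ω ρ) (unitSphere K Ω F) u := by
  obtain ⟨r, hr⟩ := exists_weight hΩo.measurableSet hρ
  obtain ⟨hFd, hFk⟩ := hF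
  have hQ : ∀ u : HK K Ω hb, inner ℝ (weightOp K Ω hb r u) u = weightQuad K Ω ρ u := fun u => by
    rw [inner_weightOp_eq K Ω hb hr]; exact (weightQuad_eq K Ω u).symm
  have hne : F ≠ ⊥ := by
    rintro rfl
    rw [finrank_bot] at hFk
    omega
  let F' : Submodule ℝ (HK K Ω hb) := F
  have : FiniteDimensional ℝ F' := hFd
  obtain ⟨u, hu, hn, hmin⟩ := CompactSymmetric.exists_isMinOn_of_finiteDimensional
    (weightOp K Ω hb r) (F := F') hne
  exact ⟨u, ⟨hu, hn⟩, fun v hv => (hQ u).symm.le.trans ((hmin v hv.1 hv.2).trans (hQ v).le)⟩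

/-- The positive value is essential to the method: compactness alone gives a maximizer on an
infinite-dimensional sphere only when the supremum is positive. -/
theorem exists_isMaxOn_perpUnitSphere (hΩo : IsOpen Ω) (hb : Bornology.IsBounded Ω)
    (hρ : MemLp ρ ∞ (volume.restrict Ω)) {F : Submodule ℝ (XK K Ω)}
    (hF : ∃ u ∈ perpUnitSphere K Ω F, 0 < weightQuad K Ω ρ u) :
    ∃ u ∈ perpUnitSphere K Ω F, IsMaxOn (weightQuad K Ω ρ) (perpUnitSphere K Ω F) u := by
  obtain ⟨r, hr⟩ := exists_weight hΩo.measurableSet hρ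
  have hQ : ∀ u : HK K Ω hb, inner ℝ (weightOp K Ω hb r u) u = weightQuad K Ω ρ u := fun u => by
    rw [inner_weightOp_eq K Ω hb hr]; exact (weightQuad_eq K Ω u).symm
  let F' : Submodule ℝ (HK K Ω hb) := F
  obtain ⟨u, hu, hp⟩ := hF
  obtain ⟨e, he, hn, -, hmax⟩ := CompactSymmetric.exists_isMax (weightOp K Ω hb r)
    (isCompactOperator_weightOp K Ω hb r) (weightOp_symm K Ω hb r) F'ᗮ
    (Submodule.isClosed_orthogonal _)
    ⟨u, (Submodule.mem_orthogonal' _ _).mpr hu.1, hp.trans_le (hQ u).symm.le⟩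
  refine ⟨e, ⟨(Submodule.mem_orthogonal' _ _).mp he, hn⟩, fun v hv => ?_⟩
  let v' : HK K Ω hb := v
  have h1 := hmax v' ((Submodule.mem_orthogonal' _ _).mpr hv.1)
  have h2 : ‖v'‖ = 1 := hv.2
  rw [h2, one_pow, mul_one] at h1
  exact (hQ v').symm.le.trans (h1.trans (hQ e).le)

theorem exists_mem_unitSphere_perp (hb : Bornology.IsBounded Ω) {k m : ℕ}
    {F G : Submodule ℝ (XK K Ω)} (hF : F ∈ subspacesOfDim K Ω k) (hG : G ∈ subspacesOfDim K Ω m)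
    (h : m < k) : ∃ u ∈ unitSphere K Ω F, u ∈ perpUnitSphere K Ω G := by
  obtain ⟨hFd, hFk⟩ := hF
  obtain ⟨hGd, hGk⟩ := hG
  let F' : Submodule ℝ (HK K Ω hb) := F
  let G' : Submodule ℝ (HK K Ω hb) := G
  have : FiniteDimensional ℝ F' := hFd
  have : FiniteDimensional ℝ G' := hGd
  obtain ⟨u, hu, h0, huG⟩ := CompactSymmetric.exists_mem_orthogonal_of_finrank_lt (F := F')
    (G := G') (by
      have h1 : Module.finrank ℝ F' = k := hFk
      have h2 : Module.finrank ℝ G' = m := hGk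
      omega)
  have hn : ‖u‖ ≠ 0 := norm_ne_zero_iff.mpr h0
  have h1 : ‖‖u‖⁻¹ • u‖ = 1 := by simp [norm_smul, hn]
  have h2 : ‖u‖⁻¹ • u ∈ G'ᗮ := Submodule.smul_mem _ _ huG
  exact ⟨‖u‖⁻¹ • u, ⟨F'.smul_mem _ hu, h1⟩, (Submodule.mem_orthogonal' _ _).mp h2, h1⟩

theorem exists_abs_weightQuad_le (hΩo : IsOpen Ω) (hb : Bornology.IsBounded Ω)
    (hρ : MemLp ρ ∞ (volume.restrict Ω)) :
    ∃ C, ∀ u : XK K Ω, nrm K Ω u = 1 → |weightQuad K Ω ρ u| ≤ C := by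
  obtain ⟨r, hr⟩ := exists_weight hΩo.measurableSet hρ
  refine ⟨‖weightOp K Ω hb r‖, fun u hu => ?_⟩
  let u' : HK K Ω hb := u
  have hQ : weightQuad K Ω ρ u = inner ℝ (weightOp K Ω hb r u') u' := by
    rw [inner_weightOp_eq K Ω hb hr]; exact weightQuad_eq K Ω u
  have hu' : ‖u'‖ = 1 := hu
  rw [hQ]
  refine (abs_real_inner_le_norm _ _).trans ?_
  have h1 := (weightOp K Ω hb r).le_opNorm u'
  rw [hu', mul_one] at h1 ⊢
  exact h1

theorem bddBelow_unitSphere (hΩo : IsOpen Ω) (hb : Bornology.IsBounded Ω)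
    (hρ : MemLp ρ ∞ (volume.restrict Ω)) (F : Submodule ℝ (XK K Ω)) :
    BddBelow (weightQuad K Ω ρ '' unitSphere K Ω F) := by
  obtain ⟨C, hC⟩ := exists_abs_weightQuad_le (K := K) hΩo hb hρ
  refine ⟨-C, ?_⟩
  rintro _ ⟨u, hu, rfl⟩
  exact (abs_le.mp (hC u hu.2)).1

theorem bddAbove_perpUnitSphere (hΩo : IsOpen Ω) (hb : Bornology.IsBounded Ω)
    (hρ : MemLp ρ ∞ (volume.restrict Ω)) (F : Submodule ℝ (XK K Ω)) :
    BddAbove (weightQuad K Ω ρ '' perpUnitSphere K Ω F) := by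
  obtain ⟨C, hC⟩ := exists_abs_weightQuad_le (K := K) hΩo hb hρ
  refine ⟨C, ?_⟩
  rintro _ ⟨u, hu, rfl⟩
  exact (abs_le.mp (hC u hu.2)).2

namespace IsEigenSequence

variable {e : ℕ → XK K Ω} {μ : ℕ → ℝ}

theorem nrm_eq_one (h : IsEigenSequence K Ω ρ e μ) (n : ℕ) : nrm K Ω (e n) = 1 := by
  have h1 := nrm_sq (e n)
  rw [h.ip_eq, if_pos rfl] at h1
  exact (pow_eq_one_iff_of_nonneg (Real.sqrt_nonneg _) two_ne_zero).mp h1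

theorem weightQuad_eq_mu (h : IsEigenSequence K Ω ρ e μ) (n : ℕ) :
    weightQuad K Ω ρ (e n) = μ n := by
  rw [weightQuad_eq, h.form_eq, h.ip_eq, if_pos rfl, mul_one]

theorem ne_zero (h : IsEigenSequence K Ω ρ e μ) (n : ℕ) : e n ≠ 0 := by
  intro h0
  have h1 := h.weightQuad_eq_mu n
  have h3 := h.pos n
  have h4 : weightQuad K Ω ρ (0 : XK K Ω) = 0 := by simp [weightQuad]
  rw [h0, h4] at h1
  linarith

theorem orthonormal (h : IsEigenSequence K Ω ρ e μ) (hb : Bornology.IsBounded Ω) :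
    Orthonormal ℝ (show ℕ → HK K Ω hb from e) :=
  orthonormal_iff_ite.mpr fun i j => h.ip_eq i j

theorem span_mem (h : IsEigenSequence K Ω ρ e μ) (hb : Bornology.IsBounded Ω) (s : Finset ℕ) :
    Submodule.span ℝ (e '' s) ∈ subspacesOfDim K Ω s.card := by
  refine ⟨FiniteDimensional.span_of_finite ℝ (s.finite_toSet.image e), ?_⟩
  have hl : LinearIndependent ℝ e := (h.orthonormal hb).linearIndependent
  have hli : LinearIndependent ℝ (fun i : s => e i) := hl.comp _ Subtype.val_injective
  have := finrank_span_eq_card hli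
  have hr : Set.range (fun i : s => e i) = e '' s := by
    ext; simp
  rw [hr] at this
  simpa using this

theorem span_Iio_mem (h : IsEigenSequence K Ω ρ e μ) (hb : Bornology.IsBounded Ω) (n : ℕ) :
    Submodule.span ℝ (e '' Set.Iio n) ∈ subspacesOfDim K Ω n := by
  simpa using h.span_mem hb (Finset.range n)

theorem ip_eq_zero_of_mem_span (h : IsEigenSequence K Ω ρ e μ) (hb : Bornology.IsBounded Ω)
    {s t : Set ℕ} (hst : Disjoint s t) {u v : XK K Ω} (hu : u ∈ Submodule.span ℝ (e '' s))
    (hv : v ∈ Submodule.span ℝ (e '' t)) : ip K Ω u v = 0 := by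
  have key : (Submodule.span ℝ (e '' s) : Submodule ℝ (HK K Ω hb)) ⟂
      (Submodule.span ℝ (e '' t) : Submodule ℝ (HK K Ω hb)) := by
    rw [Submodule.isOrtho_span]
    rintro _ ⟨i, hi, rfl⟩ _ ⟨j, hj, rfl⟩
    have hij : i ≠ j := by
      rintro rfl
      exact Set.disjoint_left.mp hst hi hj
    exact (h.orthonormal hb).2 hij
  exact (Submodule.isOrtho_iff_inner_eq.mp key) u hu v hv

theorem mem_unitSphere (h : IsEigenSequence K Ω ρ e μ) (n : ℕ) :
    e n ∈ unitSphere K Ω (Submodule.span ℝ (e '' Set.Iio (n + 1))) :=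
  ⟨Submodule.subset_span ⟨n, Nat.lt_succ_self n, rfl⟩, h.nrm_eq_one n⟩

theorem mem_perpUnitSphere (h : IsEigenSequence K Ω ρ e μ) (hb : Bornology.IsBounded Ω) (n : ℕ) :
    e n ∈ perpUnitSphere K Ω (Submodule.span ℝ (e '' Set.Iio n)) :=
  ⟨fun v hv => h.ip_eq_zero_of_mem_span hb (s := {n}) (by simp)
    (Submodule.subset_span ⟨n, rfl, rfl⟩) hv, h.nrm_eq_one n⟩

theorem isMinOn (h : IsEigenSequence K Ω ρ e μ) (n : ℕ) :
    IsMinOn (weightQuad K Ω ρ) (unitSphere K Ω (Submodule.span ℝ (e '' Set.Iio (n + 1)))) (e n) := by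
  intro u hu
  have := h.le_quad n u hu.1
  rw [hu.2] at this
  rw [Set.mem_ofPred_eq, h.weightQuad_eq_mu]
  linarith

theorem isMaxOn (h : IsEigenSequence K Ω ρ e μ) (n : ℕ) :
    IsMaxOn (weightQuad K Ω ρ) (perpUnitSphere K Ω (Submodule.span ℝ (e '' Set.Iio n))) (e n) := by
  intro u hu
  have := h.quad_le n u hu.1
  rw [hu.2] at this
  rw [Set.mem_ofPred_eq, h.weightQuad_eq_mu]
  linarith

theorem infOn_span (h : IsEigenSequence K Ω ρ e μ) (n : ℕ) :
    infOn K Ω ρ (Submodule.span ℝ (e '' Set.Iio (n + 1))) = μ n := by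
  refine IsLeast.csInf_eq ⟨⟨e n, h.mem_unitSphere n, h.weightQuad_eq_mu n⟩, ?_⟩
  rintro _ ⟨u, hu, rfl⟩
  rw [← h.weightQuad_eq_mu]
  exact h.isMinOn n hu

theorem supOnPerp_span (h : IsEigenSequence K Ω ρ e μ) (hb : Bornology.IsBounded Ω) (n : ℕ) :
    supOnPerp K Ω ρ (Submodule.span ℝ (e '' Set.Iio n)) = μ n := by
  refine IsGreatest.csSup_eq ⟨⟨e n, h.mem_perpUnitSphere hb n, h.weightQuad_eq_mu n⟩, ?_⟩
  rintro _ ⟨u, hu, rfl⟩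
  rw [← h.weightQuad_eq_mu]
  exact h.isMaxOn n hu

/-- Fᗮ meets the span of the first n + 1 eigenfunctions, where the form is at least μ n on unit
vectors. -/
theorem exists_mu_le (h : IsEigenSequence K Ω ρ e μ) (hb : Bornology.IsBounded Ω) {n : ℕ}
    {F : Submodule ℝ (XK K Ω)} (hF : F ∈ subspacesOfDim K Ω n) :
    ∃ u ∈ perpUnitSphere K Ω F, μ n ≤ weightQuad K Ω ρ u := by
  obtain ⟨u, hu, huF⟩ := exists_mem_unitSphere_perp hb (h.span_Iio_mem hb (n + 1)) hF
    (Nat.lt_succ_self n)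
  refine ⟨u, huF, ?_⟩
  have := h.isMinOn n hu
  rwa [Set.mem_ofPred_eq, h.weightQuad_eq_mu] at this

/-- F meets the complement of the span of the first n eigenfunctions, where the form is at most μ n
on unit vectors. -/
theorem infOn_le (h : IsEigenSequence K Ω ρ e μ) (hΩo : IsOpen Ω)
    (hb : Bornology.IsBounded Ω) (hρ : MemLp ρ ∞ (volume.restrict Ω)) {n : ℕ} {F : Submodule ℝ (XK K Ω)}
    (hF : F ∈ subspacesOfDim K Ω (n + 1)) : infOn K Ω ρ F ≤ μ n := by
  obtain ⟨u, huF, hu⟩ := exists_mem_unitSphere_perp hb hF (h.span_Iio_mem hb n)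
    (Nat.lt_succ_self n)
  refine (csInf_le (bddBelow_unitSphere hΩo hb hρ F) ⟨u, huF, rfl⟩).trans ?_
  have := h.isMaxOn n hu
  rwa [Set.mem_ofPred_eq, h.weightQuad_eq_mu] at this

theorem le_supOnPerp (h : IsEigenSequence K Ω ρ e μ) (hΩo : IsOpen Ω)
    (hb : Bornology.IsBounded Ω) (hρ : MemLp ρ ∞ (volume.restrict Ω)) {n : ℕ} {F : Submodule ℝ (XK K Ω)}
    (hF : F ∈ subspacesOfDim K Ω n) : μ n ≤ supOnPerp K Ω ρ F := by
  obtain ⟨u, hu, hle⟩ := h.exists_mu_le hb hF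
  exact hle.trans (le_csSup (bddAbove_perpUnitSphere hΩo hb hρ F) ⟨u, hu, rfl⟩)

theorem supInf_eq (h : IsEigenSequence K Ω ρ e μ) (hΩo : IsOpen Ω)
    (hb : Bornology.IsBounded Ω) (hρ : MemLp ρ ∞ (volume.restrict Ω)) (n : ℕ) : supInf K Ω ρ (n + 1) = μ n := by
  refine IsGreatest.csSup_eq ⟨⟨_, h.span_Iio_mem hb (n + 1), h.infOn_span n⟩, ?_⟩
  rintro _ ⟨F, hF, rfl⟩
  exact h.infOn_le hΩo hb hρ hF

theorem infSupPerp_eq (h : IsEigenSequence K Ω ρ e μ) (hΩo : IsOpen Ω)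
    (hb : Bornology.IsBounded Ω) (hρ : MemLp ρ ∞ (volume.restrict Ω)) (n : ℕ) :
    infSupPerp K Ω ρ (n + 1) = μ n := by
  refine IsLeast.csInf_eq ⟨⟨_, h.span_Iio_mem hb n, h.supOnPerp_span hb n⟩, ?_⟩
  rintro _ ⟨F, hF, rfl⟩
  exact h.le_supOnPerp hΩo hb hρ hF

end IsEigenSequence

/-! ### The reflection ρ ↦ -ρ, and weights of constant sign. -/

theorem weightQuad_neg (u : XK K Ω) : weightQuad K Ω (-ρ) u = -weightQuad K Ω ρ u := by
  unfold weightQuad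
  rw [← integral_neg]
  congr 1; ext x
  simp

theorem weightForm_neg (u v : XK K Ω) : weightForm K Ω (-ρ) u v = -weightForm K Ω ρ u v := by
  unfold weightForm
  rw [← integral_neg]
  congr 1; ext x
  simp

theorem weightForm_comm (u v : XK K Ω) : weightForm K Ω ρ u v = weightForm K Ω ρ v u := by
  unfold weightForm
  congr 1; ext x
  ring

theorem image_neg_weight (s : Set (XK K Ω)) :
    weightQuad K Ω (-ρ) '' s = -(weightQuad K Ω ρ '' s) := by
  rw [← Set.image_neg_eq_neg, Set.image_image]
  exact Set.image_congr fun u _ => weightQuad_neg u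

/-- Exchanging supremum and infimum under negation is valid for every set of reals, with the default
values of `sSup` and `sInf` included, so neither nonemptiness nor boundedness has to be checked here
or in the next three lemmas. -/
theorem supOn_eq_neg (F : Submodule ℝ (XK K Ω)) : supOn K Ω ρ F = -infOn K Ω (-ρ) F := by
  rw [infOn, image_neg_weight, Real.sInf_neg, neg_neg]; rfl

theorem infOnPerp_eq_neg (F : Submodule ℝ (XK K Ω)) :
    infOnPerp K Ω ρ F = -supOnPerp K Ω (-ρ) F := by
  rw [supOnPerp, image_neg_weight, Real.sSup_neg, neg_neg]; rfl

theorem infSup_eq_neg (k : ℕ) : infSup K Ω ρ k = -supInf K Ω (-ρ) k := by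
  have : supOn K Ω ρ '' subspacesOfDim K Ω k = -(infOn K Ω (-ρ) '' subspacesOfDim K Ω k) := by
    rw [← Set.image_neg_eq_neg, Set.image_image]
    exact Set.image_congr fun F _ => supOn_eq_neg F
  rw [infSup, this, Real.sInf_neg]; rfl

theorem supInfPerp_eq_neg (k : ℕ) : supInfPerp K Ω ρ k = -infSupPerp K Ω (-ρ) k := by
  have : infOnPerp K Ω ρ '' subspacesOfDim K Ω (k - 1)
      = -(supOnPerp K Ω (-ρ) '' subspacesOfDim K Ω (k - 1)) := by
    rw [← Set.image_neg_eq_neg, Set.image_image]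
    exact Set.image_congr fun F _ => infOnPerp_eq_neg F
  rw [supInfPerp, this, Real.sSup_neg]; rfl

/-- If the weight is nonpositive, both sides of the positive min-max formula vanish. -/
theorem supInf_eq_infSupPerp_of_nonpos (hΩo : IsOpen Ω) (hb : Bornology.IsBounded Ω)
    (hρ : MemLp ρ ∞ (volume.restrict Ω)) (hneg : ∀ u, weightQuad K Ω ρ u ≤ 0)
    {e : ℕ → XK K Ω} {μ : ℕ → ℝ} (h : IsEigenSequence K Ω (-ρ) e μ) {k : ℕ} (hk : 1 ≤ k) :
    supInf K Ω ρ k = infSupPerp K Ω ρ k := by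
  -- Spans of k consecutive eigenfunctions of -ρ, far out in the sequence: on the unit sphere of `G
  -- m` the form lies between -μ m and 0. Letting m → ∞ shows that the supremum is 0 on both sides.
  let G : ℕ → Submodule ℝ (XK K Ω) := fun m => Submodule.span ℝ (e '' (Finset.Ico m (m + k)))
  have hG : ∀ m, G m ∈ subspacesOfDim K Ω k := fun m => by
    have h1 := h.span_mem hb (Finset.Ico m (m + k))
    rwa [Nat.card_Ico, Nat.add_sub_cancel_left] at h1
  have hGq : ∀ m, ∀ u ∈ unitSphere K Ω (G m), -μ m ≤ weightQuad K Ω ρ u := by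
    intro m u hu
    have h1 := h.quad_le m u fun v hv => h.ip_eq_zero_of_mem_span hb
      (s := ((Finset.Ico m (m + k) : Finset ℕ) : Set ℕ)) (t := Set.Iio m)
      (Set.disjoint_left.mpr fun i hi hi' => by
        simp only [Finset.coe_Ico, Set.mem_Ico] at hi
        exact absurd hi' (not_lt.mpr hi.1)) hu.1 hv
    rw [weightQuad_neg, hu.2] at h1
    linarith
  have hlim : ∀ x : ℝ, (∀ m, -μ m ≤ x) → 0 ≤ x := fun x hx => by
    have := h.tendsto.neg
    rw [neg_zero] at this
    exact le_of_tendsto' this hx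
  have hinf : ∀ F ∈ subspacesOfDim K Ω k, infOn K Ω ρ F ≤ 0 := by
    intro F hF
    obtain ⟨u, hu, -⟩ := exists_isMinOn_unitSphere hΩo hb hρ hk hF
    exact (csInf_le (bddBelow_unitSphere hΩo hb hρ F) ⟨u, hu, rfl⟩).trans (hneg u)
  have hsup : ∀ F ∈ subspacesOfDim K Ω (k - 1), supOnPerp K Ω ρ F = 0 := by
    intro F hF
    have hex : ∀ m, ∃ u ∈ perpUnitSphere K Ω F, -μ m ≤ weightQuad K Ω ρ u := fun m => by
      obtain ⟨u, hu, huF⟩ := exists_mem_unitSphere_perp hb (hG m) hF (by omega)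
      exact ⟨u, huF, hGq m u hu⟩
    obtain ⟨u₀, hu₀, -⟩ := hex 0
    refine le_antisymm (csSup_le ⟨_, u₀, hu₀, rfl⟩ ?_) (hlim _ fun m => ?_)
    · rintro _ ⟨u, _, rfl⟩
      exact hneg u
    · obtain ⟨u, hu, hle⟩ := hex m
      exact hle.trans (le_csSup (bddAbove_perpUnitSphere hΩo hb hρ F) ⟨u, hu, rfl⟩)
  have h1 : supInf K Ω ρ k = 0 := by
    refine le_antisymm (csSup_le ⟨_, G 0, hG 0, rfl⟩ ?_) (hlim _ fun m => ?_)
    · rintro _ ⟨F, hF, rfl⟩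
      exact hinf F hF
    · have hbd : BddAbove (infOn K Ω ρ '' subspacesOfDim K Ω k) :=
        ⟨0, by rintro _ ⟨F, hF, rfl⟩; exact hinf F hF⟩
      refine le_trans ?_ (le_csSup hbd ⟨G m, hG m, rfl⟩)
      obtain ⟨u, hu, -⟩ := exists_isMinOn_unitSphere hΩo hb hρ hk (hG m)
      refine le_csInf ⟨_, u, hu, rfl⟩ ?_
      rintro _ ⟨v, hv, rfl⟩
      exact hGq m v hv
  have h2 : infSupPerp K Ω ρ k = 0 := by
    refine IsLeast.csInf_eq ⟨⟨_, h.span_Iio_mem hb (k - 1), hsup _ (h.span_Iio_mem hb (k - 1))⟩, ?_⟩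
    rintro _ ⟨F, hF, rfl⟩
    exact (hsup F hF).ge
  rw [h1, h2]

theorem weightQuad_nonpos (hneg : ∀ᵐ x ∂volume.restrict Ω, ρ x ≤ 0) (u : XK K Ω) :
    weightQuad K Ω ρ u ≤ 0 := by
  refine integral_nonpos_of_ae ?_
  filter_upwards [hneg] with x hx
  exact mul_nonpos_of_nonpos_of_nonneg hx (sq_nonneg _)

theorem ae_nonpos_of_posPart (h : ρ⁺ =ᵐ[volume.restrict Ω] 0) :
    ∀ᵐ x ∂volume.restrict Ω, ρ x ≤ 0 := by
  filter_upwards [h] with x hx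
  simpa [Pi.posPart_apply] using hx

theorem supInf_eq_infSupPerp (hΩo : IsOpen Ω) (hb : Bornology.IsBounded Ω)
    (hρ : MemLp ρ ∞ (volume.restrict Ω)) (hρ0 : ¬ ρ =ᵐ[volume.restrict Ω] 0) {k : ℕ}
    (hk : 1 ≤ k) : supInf K Ω ρ k = infSupPerp K Ω ρ k := by
  by_cases hpos : ρ⁺ =ᵐ[volume.restrict Ω] 0
  · have hn := ae_nonpos_of_posPart hpos
    have hneg : ¬ (-ρ)⁺ =ᵐ[volume.restrict Ω] 0 := by
      intro h
      refine hρ0 ?_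
      filter_upwards [hn, ae_nonpos_of_posPart h] with x hx hx'
      exact le_antisymm hx (neg_nonpos.mp hx')
    obtain ⟨e, μ, h⟩ := exists_isEigenSequence (K := K) hΩo hb hρ.neg hneg
    exact supInf_eq_infSupPerp_of_nonpos hΩo hb hρ (weightQuad_nonpos hn) h hk
  · obtain ⟨e, μ, h⟩ := exists_isEigenSequence (K := K) hΩo hb hρ hpos
    obtain ⟨n, rfl⟩ := Nat.exists_eq_add_of_le' hk
    rw [h.supInf_eq hΩo hb hρ, h.infSupPerp_eq hΩo hb hρ]

/-- Testing with the eigenfunction itself gives 0 < ⟨u, u⟩ = λ∫ρu². -/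
theorem pos_of_isEigenvalue (hb : Bornology.IsBounded Ω) (hnn : ∀ u, 0 ≤ weightQuad K Ω ρ u)
    {lam : ℝ} (h : IsEigenvalue K Ω ρ lam) : 0 < lam := by
  obtain ⟨u, hu, he⟩ := h
  have h1 := ip_self_pos hb hu
  rw [he u, ← weightQuad_eq] at h1
  exact pos_of_mul_pos_left h1 (hnn u)

theorem IsEigenvalue.neg {lam : ℝ} (h : IsEigenvalue K Ω ρ lam) :
    IsEigenvalue K Ω (-ρ) (-lam) := by
  obtain ⟨u, hu, he⟩ := h
  exact ⟨u, hu, fun v => by rw [weightForm_neg, neg_mul_neg, he v]⟩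

end NonlocalEig

namespace NonlocalEig

/-! ### Indexing by nonzero integers and assembly of the two sequences. -/

variable {N : ℕ} {K : AdmissibleKernel N} {Ω : Set (Euc N)} {ρ : Euc N → ℝ}
  {a b : ℕ → XK K Ω} {μ ν : ℕ → ℝ}

theorem eig_natCast {k : ℕ} (hk : 1 ≤ k) : eig K Ω ρ k = (supInf K Ω ρ k)⁻¹ := by
  rw [eig, if_pos (by exact_mod_cast hk), Int.natAbs_natCast]

theorem eig_neg_natCast (k : ℕ) : eig K Ω ρ (-k) = -(supInf K Ω (-ρ) k)⁻¹ := by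
  rw [eig, if_neg (by omega), Int.natAbs_neg, Int.natAbs_natCast, infSup_eq_neg, inv_neg]

theorem IsEigenSequence.isEigenfunction (h : IsEigenSequence K Ω ρ a μ) (n : ℕ) :
    IsEigenfunction K Ω ρ (μ n)⁻¹ (a n) :=
  ⟨h.ne_zero n, fun v => by rw [h.form_eq, inv_mul_cancel_left₀ (h.pos n).ne']⟩

theorem IsEigenSequence.isEigenfunction_neg (h : IsEigenSequence K Ω (-ρ) b ν) (n : ℕ) :
    IsEigenfunction K Ω ρ (-(ν n)⁻¹) (b n) := by
  obtain ⟨h0, h1⟩ := h.isEigenfunction n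
  exact ⟨h0, fun v => by rw [h1 v, weightForm_neg, mul_neg, neg_mul]⟩

/-- Computing ∫ρ a_i b_j from either side gives μ_i⟨a_i, b_j⟩ = -ν_j⟨a_i, b_j⟩, with μ_i and ν_j
both positive. -/
theorem IsEigenSequence.ip_eq_zero_of_neg (h : IsEigenSequence K Ω ρ a μ)
    (h' : IsEigenSequence K Ω (-ρ) b ν) (i j : ℕ) : ip K Ω (a i) (b j) = 0 := by
  have h1 := h.form_eq i (b j)
  have h2 := h'.form_eq j (a i)
  rw [weightForm_neg, weightForm_comm, h1, ip_comm (b j)] at h2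
  have h3 := h.pos i
  have h4 := h'.pos j
  have h5 : (μ i + ν j) * ip K Ω (a i) (b j) = 0 := by linarith
  exact (mul_eq_zero.mp h5).resolve_left (by positivity)

theorem IsEigenSequence.monotone_eig (h : IsEigenSequence K Ω ρ a μ) (hΩo : IsOpen Ω)
    (hb : Bornology.IsBounded Ω) (hρ : MemLp ρ ∞ (volume.restrict Ω)) :
    0 < (supInf K Ω ρ 1)⁻¹ ∧ (supInf K Ω ρ 1)⁻¹ < (supInf K Ω ρ 2)⁻¹ ∧
      (∀ k : ℕ, 1 ≤ k → (supInf K Ω ρ k)⁻¹ ≤ (supInf K Ω ρ (k + 1))⁻¹) ∧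
      Tendsto (fun k : ℕ => (supInf K Ω ρ k)⁻¹) atTop atTop := by
  have hs := h.supInf_eq hΩo hb hρ
  refine ⟨?_, ?_, fun k hk => ?_, ?_⟩
  · rw [hs 0]; exact inv_pos.mpr (h.pos 0)
  · rw [hs 0, hs 1]
    exact inv_strictAnti₀ (h.pos 1) h.one_lt_zero
  · obtain ⟨n, rfl⟩ := Nat.exists_eq_add_of_le' hk
    rw [hs n, hs (n + 1)]
    exact inv_anti₀ (h.pos _) (h.antitone n.le_succ)
  · rw [← tendsto_add_atTop_iff_nat 1]
    simp_rw [hs]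
    refine Tendsto.inv_tendsto_nhdsGT_zero ?_
    exact tendsto_nhdsWithin_iff.mpr ⟨h.tendsto, Eventually.of_forall h.pos⟩

theorem IsEigenSequence.exists_isMaxOn (h : IsEigenSequence K Ω ρ a μ) (hΩo : IsOpen Ω)
    (hb : Bornology.IsBounded Ω) (hρ : MemLp ρ ∞ (volume.restrict Ω)) {k : ℕ}
    {F : Submodule ℝ (XK K Ω)} (hF : F ∈ subspacesOfDim K Ω k) :
    ∃ u ∈ perpUnitSphere K Ω F, IsMaxOn (weightQuad K Ω ρ) (perpUnitSphere K Ω F) u := by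
  obtain ⟨u, hu, hle⟩ := h.exists_mu_le hb hF
  exact exists_isMaxOn_perpUnitSphere hΩo hb hρ ⟨u, hu, (h.pos _).trans_le hle⟩

theorem IsEigenSequence.isMaxOn_infOn (h : IsEigenSequence K Ω ρ a μ) (hΩo : IsOpen Ω)
    (hb : Bornology.IsBounded Ω) (hρ : MemLp ρ ∞ (volume.restrict Ω)) (n : ℕ) :
    IsMaxOn (infOn K Ω ρ) (subspacesOfDim K Ω (n + 1))
      (Submodule.span ℝ (a '' Set.Iio (n + 1))) := fun F hF => by
  rw [Set.mem_ofPred_eq, h.infOn_span]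
  exact h.infOn_le hΩo hb hρ hF

theorem IsEigenSequence.isMinOn_supOnPerp (h : IsEigenSequence K Ω ρ a μ) (hΩo : IsOpen Ω)
    (hb : Bornology.IsBounded Ω) (hρ : MemLp ρ ∞ (volume.restrict Ω)) (n : ℕ) :
    IsMinOn (supOnPerp K Ω ρ) (subspacesOfDim K Ω n)
      (Submodule.span ℝ (a '' Set.Iio n)) := fun F hF => by
  rw [Set.mem_ofPred_eq, h.supOnPerp_span hb]
  exact h.le_supOnPerp hΩo hb hρ hF

theorem isMaxOn_of_neg {s : Set (XK K Ω)} {u : XK K Ω} (h : IsMinOn (weightQuad K Ω (-ρ)) s u) :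
    IsMaxOn (weightQuad K Ω ρ) s u := fun v hv => by
  have : weightQuad K Ω (-ρ) u ≤ weightQuad K Ω (-ρ) v := h hv
  rw [weightQuad_neg, weightQuad_neg] at this
  exact neg_le_neg_iff.mp this

theorem isMinOn_of_neg {s : Set (XK K Ω)} {u : XK K Ω} (h : IsMaxOn (weightQuad K Ω (-ρ)) s u) :
    IsMinOn (weightQuad K Ω ρ) s u := fun v hv => by
  have : weightQuad K Ω (-ρ) v ≤ weightQuad K Ω (-ρ) u := h hv
  rw [weightQuad_neg, weightQuad_neg] at this
  exact neg_le_neg_iff.mp this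

/-- The family indexed by the nonzero integers made of two sequences. -/
def signedSeq {α : Type*} (a b : ℕ → α) (k : ℤ) : α :=
  if 0 < k then a (k.toNat - 1) else b ((-k).toNat - 1)

/-- The sequences start at 0 and the eigenvalue indices at ±1, hence the shift. The index 0 receives
the value `b 0` by default and is never admissible. -/
theorem signedSeq_pos {α : Type*} (a b : ℕ → α) (n : ℕ) :
    signedSeq a b ((n + 1 : ℕ) : ℤ) = a n := by
  rw [signedSeq, if_pos (by omega)]
  congr 1

theorem signedSeq_neg {α : Type*} (a b : ℕ → α) (n : ℕ) :
    signedSeq a b (-((n + 1 : ℕ) : ℤ)) = b n := by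
  rw [signedSeq, if_neg (by omega)]
  congr 1

theorem exists_nat_of_pos {k : ℤ} (hk : 0 < k) : ∃ n : ℕ, k = ((n + 1 : ℕ) : ℤ) :=
  ⟨k.toNat - 1, by omega⟩

theorem exists_nat_of_neg {k : ℤ} (hk : k < 0) : ∃ n : ℕ, k = -((n + 1 : ℕ) : ℤ) :=
  ⟨(-k).toNat - 1, by omega⟩

theorem signedSeq_image_pos {α : Type*} (a b : ℕ → α) {s : Set ℤ} {n : ℕ}
    (hs : ∀ k, k ∈ s ↔ 1 ≤ k ∧ k < n + 1) : signedSeq a b '' s = a '' Set.Iio n := by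
  ext x
  constructor
  · rintro ⟨k, hk, rfl⟩
    obtain ⟨h1, h2⟩ := (hs k).mp hk
    obtain ⟨m, rfl⟩ := exists_nat_of_pos (show 0 < k by omega)
    exact ⟨m, by simp only [Set.mem_Iio]; omega, (signedSeq_pos a b m).symm⟩
  · rintro ⟨m, hm, rfl⟩
    rw [Set.mem_Iio] at hm
    exact ⟨((m + 1 : ℕ) : ℤ), (hs _).mpr (by omega), signedSeq_pos a b m⟩

theorem signedSeq_image_neg {α : Type*} (a b : ℕ → α) {s : Set ℤ} {n : ℕ}
    (hs : ∀ k, k ∈ s ↔ k ≤ -1 ∧ -(n + 1 : ℤ) < k) : signedSeq a b '' s = b '' Set.Iio n := by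
  ext x
  constructor
  · rintro ⟨k, hk, rfl⟩
    obtain ⟨h1, h2⟩ := (hs k).mp hk
    obtain ⟨m, rfl⟩ := exists_nat_of_neg (show k < 0 by omega)
    exact ⟨m, by simp only [Set.mem_Iio]; omega, (signedSeq_neg a b m).symm⟩
  · rintro ⟨m, hm, rfl⟩
    rw [Set.mem_Iio] at hm
    exact ⟨-((m + 1 : ℕ) : ℤ), (hs _).mpr (by omega), signedSeq_neg a b m⟩

theorem eig_succ (h : IsEigenSequence K Ω ρ a μ) (hΩo : IsOpen Ω)
    (hb : Bornology.IsBounded Ω) (hρ : MemLp ρ ∞ (volume.restrict Ω)) (n : ℕ) :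
    eig K Ω ρ ((n + 1 : ℕ) : ℤ) = (μ n)⁻¹ := by
  rw [eig_natCast (by omega), h.supInf_eq hΩo hb hρ]

theorem eig_neg_succ (h : IsEigenSequence K Ω (-ρ) b ν) (hΩo : IsOpen Ω)
    (hb : Bornology.IsBounded Ω) (hρ : MemLp ρ ∞ (volume.restrict Ω)) (n : ℕ) :
    eig K Ω ρ (-((n + 1 : ℕ) : ℤ)) = -(ν n)⁻¹ := by
  rw [eig_neg_natCast, h.supInf_eq hΩo hb hρ.neg]

theorem IsEigenSequence.attained (h : IsEigenSequence K Ω ρ a μ) (b : ℕ → XK K Ω) (hΩo : IsOpen Ω)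
    (hΩb : Bornology.IsBounded Ω) (hρ : MemLp ρ ∞ (volume.restrict Ω)) {k : ℕ} (hk : 1 ≤ k) :
        weightQuad K Ω ρ (signedSeq a b k) = (eig K Ω ρ k)⁻¹ ∧
        (∃ F ∈ subspacesOfDim K Ω k,
          F = Submodule.span ℝ (signedSeq a b '' Set.Icc 1 (k : ℤ)) ∧
          IsMaxOn (infOn K Ω ρ) (subspacesOfDim K Ω k) F ∧
          signedSeq a b k ∈ unitSphere K Ω F ∧
          IsMinOn (weightQuad K Ω ρ) (unitSphere K Ω F) (signedSeq a b k)) ∧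
        (∃ F ∈ subspacesOfDim K Ω (k - 1),
          F = Submodule.span ℝ (signedSeq a b '' Set.Ico 1 (k : ℤ)) ∧
          IsMinOn (supOnPerp K Ω ρ) (subspacesOfDim K Ω (k - 1)) F ∧
          signedSeq a b k ∈ perpUnitSphere K Ω F ∧
          IsMaxOn (weightQuad K Ω ρ) (perpUnitSphere K Ω F) (signedSeq a b k)) := by
  obtain ⟨n, rfl⟩ := Nat.exists_eq_add_of_le' hk
  have i1 : signedSeq a b '' Set.Icc 1 ((n + 1 : ℕ) : ℤ) = a '' Set.Iio (n + 1) :=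
    signedSeq_image_pos a b fun k => by rw [Set.mem_Icc]; omega
  have i2 : signedSeq a b '' Set.Ico 1 ((n + 1 : ℕ) : ℤ) = a '' Set.Iio n :=
    signedSeq_image_pos a b fun k => by rw [Set.mem_Ico]; omega
  rw [i1, i2, signedSeq_pos a b n, eig_succ h hΩo hΩb hρ, inv_inv]
  exact ⟨h.weightQuad_eq_mu n,
    ⟨_, h.span_Iio_mem hΩb (n + 1), rfl, h.isMaxOn_infOn hΩo hΩb hρ n, h.mem_unitSphere n,
      h.isMinOn n⟩,
    ⟨_, h.span_Iio_mem hΩb n, rfl, h.isMinOn_supOnPerp hΩo hΩb hρ n, h.mem_perpUnitSphere hΩb n,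
      h.isMaxOn n⟩⟩

theorem IsEigenSequence.attained_neg (h : IsEigenSequence K Ω (-ρ) b ν) (a : ℕ → XK K Ω)
    (hΩo : IsOpen Ω) (hΩb : Bornology.IsBounded Ω) (hρ : MemLp ρ ∞ (volume.restrict Ω)) {k : ℕ}
    (hk : 1 ≤ k) :
        weightQuad K Ω ρ (signedSeq a b (-k)) = (eig K Ω ρ (-k))⁻¹ ∧
        (∃ F ∈ subspacesOfDim K Ω k,
          F = Submodule.span ℝ (signedSeq a b '' Set.Icc (-(k : ℤ)) (-1)) ∧
          IsMinOn (supOn K Ω ρ) (subspacesOfDim K Ω k) F ∧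
          signedSeq a b (-k) ∈ unitSphere K Ω F ∧
          IsMaxOn (weightQuad K Ω ρ) (unitSphere K Ω F) (signedSeq a b (-k))) ∧
        (∃ F ∈ subspacesOfDim K Ω (k - 1),
          F = Submodule.span ℝ (signedSeq a b '' Set.Ioc (-(k : ℤ)) (-1)) ∧
          IsMaxOn (infOnPerp K Ω ρ) (subspacesOfDim K Ω (k - 1)) F ∧
          signedSeq a b (-k) ∈ perpUnitSphere K Ω F ∧
          IsMinOn (weightQuad K Ω ρ) (perpUnitSphere K Ω F) (signedSeq a b (-k))) := by
  obtain ⟨n, rfl⟩ := Nat.exists_eq_add_of_le' hk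
  have i1 : signedSeq a b '' Set.Icc (-((n + 1 : ℕ) : ℤ)) (-1) = b '' Set.Iio (n + 1) :=
    signedSeq_image_neg a b fun k => by rw [Set.mem_Icc]; omega
  have i2 : signedSeq a b '' Set.Ioc (-((n + 1 : ℕ) : ℤ)) (-1) = b '' Set.Iio n :=
    signedSeq_image_neg a b fun k => by rw [Set.mem_Ioc]; omega
  rw [i1, i2, signedSeq_neg a b n, eig_neg_succ h hΩo hΩb hρ, inv_neg, inv_inv]
  refine ⟨?_, ⟨_, h.span_Iio_mem hΩb (n + 1), rfl, fun F hF => ?_, h.mem_unitSphere n,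
      isMaxOn_of_neg (h.isMinOn n)⟩,
    ⟨_, h.span_Iio_mem hΩb n, rfl, fun F hF => ?_, h.mem_perpUnitSphere hΩb n,
      isMinOn_of_neg (h.isMaxOn n)⟩⟩
  · rw [← h.weightQuad_eq_mu n, weightQuad_neg, neg_neg]
  · rw [Set.mem_ofPred_eq, supOn_eq_neg, supOn_eq_neg]
    have h1 := h.isMaxOn_infOn hΩo hΩb hρ.neg n hF
    rw [Set.mem_ofPred_eq] at h1
    exact neg_le_neg h1
  · rw [Set.mem_ofPred_eq, infOnPerp_eq_neg, infOnPerp_eq_neg]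
    have h1 := h.isMinOn_supOnPerp hΩo hΩb hρ.neg n hF
    rw [Set.mem_ofPred_eq] at h1
    exact neg_le_neg h1

end NonlocalEig

open NonlocalEig in
theorem proposition2p1 {N : ℕ} (K : AdmissibleKernel N) (Ω : Set (Euc N))
    (hΩo : IsOpen Ω) (hΩc : IsConnected Ω) (hΩb : Bornology.IsBounded Ω)
    (ρ : Euc N → ℝ) (hρ : MemLp ρ ∞ (volume.restrict Ω))
    (hρ0 : ¬ ρ =ᵐ[volume.restrict Ω] 0) :
    -- in each of the two lines of min-max formulas, both expressions agree
    (∀ k : ℕ, 1 ≤ k → supInf K Ω ρ k = infSupPerp K Ω ρ k ∧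
      infSup K Ω ρ k = supInfPerp K Ω ρ k) ∧
    -- positive eigenvalues
    (¬ ρ⁺ =ᵐ[volume.restrict Ω] 0 →
      0 < eig K Ω ρ 1 ∧ eig K Ω ρ 1 < eig K Ω ρ 2 ∧
      (∀ k : ℕ, 1 ≤ k → eig K Ω ρ k ≤ eig K Ω ρ (k + 1)) ∧
      Tendsto (fun k : ℕ => eig K Ω ρ k) atTop atTop) ∧
    -- negative eigenvalues
    (¬ ρ⁻ =ᵐ[volume.restrict Ω] 0 →
      eig K Ω ρ (-1) < 0 ∧ eig K Ω ρ (-2) < eig K Ω ρ (-1) ∧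
      (∀ k : ℕ, 1 ≤ k → eig K Ω ρ (-(k + 1)) ≤ eig K Ω ρ (-k)) ∧
      Tendsto (fun k : ℕ => eig K Ω ρ (-k)) atTop atBot) ∧
    -- all inner infima and suprema are attained
    (¬ ρ⁺ =ᵐ[volume.restrict Ω] 0 → ∀ k : ℕ, 1 ≤ k →
      (∀ F ∈ subspacesOfDim K Ω k, ∃ u ∈ unitSphere K Ω F,
        IsMinOn (weightQuad K Ω ρ) (unitSphere K Ω F) u) ∧
      (∀ F ∈ subspacesOfDim K Ω (k - 1), ∃ u ∈ perpUnitSphere K Ω F,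
        IsMaxOn (weightQuad K Ω ρ) (perpUnitSphere K Ω F) u)) ∧
    (¬ ρ⁻ =ᵐ[volume.restrict Ω] 0 → ∀ k : ℕ, 1 ≤ k →
      (∀ F ∈ subspacesOfDim K Ω k, ∃ u ∈ unitSphere K Ω F,
        IsMaxOn (weightQuad K Ω ρ) (unitSphere K Ω F) u) ∧
      (∀ F ∈ subspacesOfDim K Ω (k - 1), ∃ u ∈ perpUnitSphere K Ω F,
        IsMinOn (weightQuad K Ω ρ) (perpUnitSphere K Ω F) u)) ∧
    -- weights of constant sign
    ((∀ᵐ x ∂volume.restrict Ω, 0 ≤ ρ x) → ∀ lam : ℝ, IsEigenvalue K Ω ρ lam → 0 < lam) ∧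
    ((∀ᵐ x ∂volume.restrict Ω, ρ x ≤ 0) → ∀ lam : ℝ, IsEigenvalue K Ω ρ lam → lam < 0) ∧
    -- the eigenfunctions
    (∃ e : ℤ → XK K Ω,
      (∀ k : ℤ, Admissible Ω ρ k → IsEigenfunction K Ω ρ (eig K Ω ρ k) (e k)) ∧
      (∀ k h : ℤ, Admissible Ω ρ k → Admissible Ω ρ h →
        ip K Ω (e k) (e h) = if k = h then 1 else 0) ∧
      -- they and the subspaces they generate attain the extrema in the positive formulas
      (¬ ρ⁺ =ᵐ[volume.restrict Ω] 0 → ∀ k : ℕ, 1 ≤ k →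
        weightQuad K Ω ρ (e k) = (eig K Ω ρ k)⁻¹ ∧
        (∃ F ∈ subspacesOfDim K Ω k, F = Submodule.span ℝ (e '' Set.Icc 1 (k : ℤ)) ∧
          IsMaxOn (infOn K Ω ρ) (subspacesOfDim K Ω k) F ∧
          e k ∈ unitSphere K Ω F ∧
          IsMinOn (weightQuad K Ω ρ) (unitSphere K Ω F) (e k)) ∧
        (∃ F ∈ subspacesOfDim K Ω (k - 1), F = Submodule.span ℝ (e '' Set.Ico 1 (k : ℤ)) ∧
          IsMinOn (supOnPerp K Ω ρ) (subspacesOfDim K Ω (k - 1)) F ∧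
          e k ∈ perpUnitSphere K Ω F ∧
          IsMaxOn (weightQuad K Ω ρ) (perpUnitSphere K Ω F) (e k))) ∧
      -- and in the negative formulas
      (¬ ρ⁻ =ᵐ[volume.restrict Ω] 0 → ∀ k : ℕ, 1 ≤ k →
        weightQuad K Ω ρ (e (-k)) = (eig K Ω ρ (-k))⁻¹ ∧
        (∃ F ∈ subspacesOfDim K Ω k, F = Submodule.span ℝ (e '' Set.Icc (-(k : ℤ)) (-1)) ∧
          IsMinOn (supOn K Ω ρ) (subspacesOfDim K Ω k) F ∧
          e (-k) ∈ unitSphere K Ω F ∧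
          IsMaxOn (weightQuad K Ω ρ) (unitSphere K Ω F) (e (-k))) ∧
        (∃ F ∈ subspacesOfDim K Ω (k - 1), F = Submodule.span ℝ (e '' Set.Ioc (-(k : ℤ)) (-1)) ∧
          IsMaxOn (infOnPerp K Ω ρ) (subspacesOfDim K Ω (k - 1)) F ∧
          e (-k) ∈ perpUnitSphere K Ω F ∧
          IsMinOn (weightQuad K Ω ρ) (perpUnitSphere K Ω F) (e (-k))))) := by
  have hneg : (-ρ)⁺ = ρ⁻ := posPart_neg ρ
  have hpseq : ∃ a μ, ¬ ρ⁺ =ᵐ[volume.restrict Ω] 0 → IsEigenSequence K Ω ρ a μ := by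
    by_cases h : ρ⁺ =ᵐ[volume.restrict Ω] 0
    -- Where ρ⁺ vanishes the sequence is arbitrary: no positive index is admissible, but the family
    -- over ℤ still needs values. The same holds for ρ⁻ below.
    · exact ⟨0, 0, fun h' => absurd h h'⟩
    · obtain ⟨a, μ, h⟩ := exists_isEigenSequence (K := K) hΩo hΩb hρ h
      exact ⟨a, μ, fun _ => h⟩
  have hnseq : ∃ b ν, ¬ ρ⁻ =ᵐ[volume.restrict Ω] 0 → IsEigenSequence K Ω (-ρ) b ν := by
    by_cases h : ρ⁻ =ᵐ[volume.restrict Ω] 0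
    · exact ⟨0, 0, fun h' => absurd h h'⟩
    · obtain ⟨b, ν, h⟩ := exists_isEigenSequence (K := K) hΩo hΩb hρ.neg (by rwa [hneg])
      exact ⟨b, ν, fun _ => h⟩
  obtain ⟨a, μ, ha⟩ := hpseq
  obtain ⟨b, ν, hb⟩ := hnseq
  have hρ0' : ¬ -ρ =ᵐ[volume.restrict Ω] 0 := fun h => hρ0 (by
    filter_upwards [h] with x hx
    exact neg_eq_zero.mp hx)
  refine ⟨fun k hk => ⟨supInf_eq_infSupPerp hΩo hΩb hρ hρ0 hk, ?_⟩, fun hp => ?_, fun hn => ?_,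
    fun hp k hk => ⟨fun F hF => exists_isMinOn_unitSphere hΩo hΩb hρ hk hF,
      fun F hF => (ha hp).exists_isMaxOn hΩo hΩb hρ hF⟩,
    fun hn k hk => ⟨fun F hF => ?_, fun F hF => ?_⟩, fun h lam hlam => ?_, fun h lam hlam => ?_,
    signedSeq a b, fun k hk => ?_, fun k h hk hh => ?_, fun hp k hk => ?_, fun hn k hk => ?_⟩
  · rw [infSup_eq_neg, supInfPerp_eq_neg, supInf_eq_infSupPerp hΩo hΩb hρ.neg hρ0' hk]
  · obtain ⟨h1, h2, h3, h4⟩ := (ha hp).monotone_eig hΩo hΩb hρ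
    have e1 := eig_natCast (K := K) (Ω := Ω) (ρ := ρ) (k := 1) le_rfl
    have e2 := eig_natCast (K := K) (Ω := Ω) (ρ := ρ) (k := 2) (by norm_num)
    push_cast at e1 e2
    refine ⟨by rwa [e1], by rwa [e1, e2], fun k hk => ?_, ?_⟩
    · have e3 := eig_natCast (K := K) (Ω := Ω) (ρ := ρ) (k := k + 1) (by omega)
      push_cast at e3
      rw [eig_natCast hk, e3]
      exact h3 k hk
    · refine h4.congr' ?_
      -- At k = 0 `eig` takes the branch with `infSup`, so the two sequences are compared only from
      -- k = 1 on.
      filter_upwards [eventually_ge_atTop 1] with k hk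
      rw [eig_natCast hk]
  · obtain ⟨h1, h2, h3, h4⟩ := (hb hn).monotone_eig hΩo hΩb hρ.neg
    have e1 := eig_neg_natCast (K := K) (Ω := Ω) (ρ := ρ) 1
    have e2 := eig_neg_natCast (K := K) (Ω := Ω) (ρ := ρ) 2
    push_cast at e1 e2
    refine ⟨by rw [e1]; linarith, by rw [e1, e2]; linarith, fun k hk => ?_, ?_⟩
    · have e3 := eig_neg_natCast (K := K) (Ω := Ω) (ρ := ρ) (k + 1)
      push_cast at e3
      rw [eig_neg_natCast, e3]
      exact neg_le_neg (h3 k hk)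
    · simp_rw [eig_neg_natCast]
      exact tendsto_neg_atTop_atBot.comp h4
  · obtain ⟨u, hu, hmin⟩ := exists_isMinOn_unitSphere hΩo hΩb hρ.neg hk hF
    exact ⟨u, hu, isMaxOn_of_neg hmin⟩
  · obtain ⟨u, hu, hmax⟩ := (hb hn).exists_isMaxOn hΩo hΩb hρ.neg hF
    exact ⟨u, hu, isMinOn_of_neg hmax⟩
  · refine pos_of_isEigenvalue hΩb (fun u => ?_) hlam
    have h1 := weightQuad_nonpos (ρ := -ρ) (h.mono fun x hx => neg_nonpos.mpr hx) u
    rw [weightQuad_neg] at h1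
    linarith
  · refine neg_pos.mp (pos_of_isEigenvalue hΩb (fun u => ?_) hlam.neg)
    rw [weightQuad_neg]
    linarith [weightQuad_nonpos h u]
  · rcases hk with ⟨hk, hp⟩ | ⟨hk, hn⟩
    · obtain ⟨n, rfl⟩ := exists_nat_of_pos hk
      rw [eig_succ (ha hp) hΩo hΩb hρ, signedSeq_pos]
      exact (ha hp).isEigenfunction n
    · obtain ⟨n, rfl⟩ := exists_nat_of_neg hk
      rw [eig_neg_succ (hb hn) hΩo hΩb hρ, signedSeq_neg]
      exact (hb hn).isEigenfunction_neg n
  · rcases hk with ⟨hk, hp⟩ | ⟨hk, hn⟩ <;> rcases hh with ⟨hh, hp'⟩ | ⟨hh, hn'⟩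
    · obtain ⟨n, rfl⟩ := exists_nat_of_pos hk
      obtain ⟨m, rfl⟩ := exists_nat_of_pos hh
      rw [signedSeq_pos, signedSeq_pos, (ha hp).ip_eq]
      simp
    · obtain ⟨n, rfl⟩ := exists_nat_of_pos hk
      obtain ⟨m, rfl⟩ := exists_nat_of_neg hh
      rw [signedSeq_pos, signedSeq_neg, (ha hp).ip_eq_zero_of_neg (hb hn'), if_neg (by omega)]
    · obtain ⟨n, rfl⟩ := exists_nat_of_neg hk
      obtain ⟨m, rfl⟩ := exists_nat_of_pos hh
      rw [signedSeq_pos, signedSeq_neg, ip_comm, (ha hp').ip_eq_zero_of_neg (hb hn),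
        if_neg (by omega)]
    · obtain ⟨n, rfl⟩ := exists_nat_of_neg hk
      obtain ⟨m, rfl⟩ := exists_nat_of_neg hh
      rw [signedSeq_neg, signedSeq_neg, (hb hn).ip_eq]
      simp
  · exact (ha hp).attained b hΩo hΩb hρ hk
  · exact (hb hn).attained_neg a hΩo hΩb hρ hk
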